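/- Let $M,N,K\ge 1$ be integers. A configuration of the dimer model on the $M\times N\times K$ hexagon of the hexagonal lattice, viewed as a pile of unit cubes in the corner of an $M\times N\times K$ box, is encoded by its height table $h=(h_{ij})_{1\le i\le M,\,1\le j\le N}$ with $h_{ij}\in\{0,\dots,K\}$, $h_{ij}\le h_{i-1,j}$ and $h_{ij}\le h_{i,j-1}$ (whenever the indices make sense). For $q=e^{-\varepsilon}$, $\varepsilon>0$, let $$Z=Z(M,N,K,q)=\sum_{h}q^{\sum_{i,j}h_{ij}},\qquad V=2(MN+NK+MK),\qquad f=-\frac1V\ln Z$$ be the partition function, the number of vertices and the free energy per site. Let $\chi(z)=e^{-z}\left(\frac{z}{1-e^{-z}}\right)^2$ with $\chi(0)=1$, $\xi(z)=e^{z}\chi''(z)$, $Q(z)=\frac{\xi(z)-\xi(0)}{z}$, and $\mathrm{Li}_3(x)=\sum_{n\ge1}x^n/n^3$. Then $\int_0^\infty e^{-z}Q(z)\,dz$ converges absolutely. For $a,b,c>0$ put $$f_0=\frac{1}{2(ab+bc+ca)}\Big[\mathrm{Li}_3(e^{-a})+\mathrm{Li}_3(e^{-b})+\mathrm{Li}_3(e^{-c})-\mathrm{Li}_3(e^{-a-b})-\mathrm{Li}_3(e^{-b-c})-\mathrm{Li}_3(e^{-a-c})+\mathrm{Li}_3(e^{-a-b-c})-\zeta(3)\Big],$$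 $$f_1=0,\qquad f_2=-\frac{1}{24(ab+bc+ca)},$$ $$f_3=-\frac{1}{2(ab+bc+ca)}\left[-\frac1{12}\ln\left(\frac{(e^{a}-1)(e^{b}-1)(e^{c}-1)(e^{a+b+c}-1)}{(e^{a+b}-1)(e^{b+c}-1)(e^{a+c}-1)}\right)-\frac18+\frac12\int_0^\infty e^{-z}Q(z)\,dz\right].$$ Then, as $\varepsilon\to0^+$ with $M=a/\varepsilon$, $N=b/\varepsilon$, $K=c/\varepsilon$ integers, $$f=f_0+f_1\,\varepsilon+f_2\,\varepsilon^2\ln\varepsilon+f_3\,\varepsilon^2+O(\varepsilon^3),$$ where the implied constant may be chosen uniformly for $a,b,c\ge\delta$, for each fixed $\delta>0$: for every $\delta>0$ there are $C$ and $\varepsilon_0>0$ such that the difference of the two sides without the error term is at most $C\varepsilon^3$ in absolute value for all $a,b,c\ge\delta$ and all $0<\varepsilon<\varepsilon_0$ for which $a/\varepsilon$, $b/\varepsilon$, $c/\varepsilon$ are integers. -/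

import Mathlib

namespace HexDimer

noncomputable section

/-! ### The model: `q ^ volume`-weighted configurations on the `M × N × K` hexagon -/

/-- An `M × N` table of heights in `{0, …, K}` encodes a dimer covering of the `M × N × K` hexagon
(a pile of unit cubes in the corner of a box) when no height exceeds that of the neighbouring
cell above it or to its left. -/
def IsConfig {M N K : ℕ} (h : Fin M → Fin N → Fin (K + 1)) : Prop :=
  (∀ (i i' : Fin M) (j : Fin N), (i' : ℕ) + 1 = (i : ℕ) → h i j ≤ h i' j) ∧
    (∀ (i : Fin M) (j j' : Fin N), (j' : ℕ) + 1 = (j : ℕ) → h i j ≤ h i j')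

/-- The number of unit cubes in the pile (this is the energy of the configuration). -/
def volume {M N K : ℕ} (h : Fin M → Fin N → Fin (K + 1)) : ℕ :=
  ∑ i, ∑ j, (h i j : ℕ)

open Classical in
/-- The partition function: the sum of `q ^ volume` over all configurations. -/
def partitionFunction (M N K : ℕ) (q : ℝ) : ℝ :=
  ∑ h ∈ (Finset.univ : Finset (Fin M → Fin N → Fin (K + 1))).filter IsConfig, q ^ volume h

/-- The number of vertices of the hexagonal domain with sides `M`, `N`, `K`. -/
def numVertices (M N K : ℕ) : ℕ := 2 * (M * N + N * K + M * K)

/-- The free energy per site, at inverse temperature `ε`, that is, at `q = exp (-ε)`. -/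
def freeEnergy (M N K : ℕ) (ε : ℝ) : ℝ :=
  -(1 / (numVertices M N K : ℝ)) * Real.log (partitionFunction M N K (Real.exp (-ε)))

/-! ### The functions in the coefficients -/

/-- The trilogarithm `Li₃(x) = ∑_{n ≥ 1} xⁿ / n³`. -/
def Li3 (x : ℝ) : ℝ := ∑' n : ℕ, x ^ (n + 1) / ((n : ℝ) + 1) ^ 3

/-- `χ(z) = e^{-z} (z / (1 - e^{-z}))²`, with its removable singularity at `0` filled in. -/
def chi (z : ℝ) : ℝ :=
  if z = 0 then 1 else Real.exp (-z) * (z / (1 - Real.exp (-z))) ^ 2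

/-- The function `ξ` defined by `χ''(z) = e^{-z} ξ(z)`. -/
def xi (z : ℝ) : ℝ := Real.exp z * iteratedDeriv 2 chi z

/-- `Q(z) = (ξ(z) - ξ(0)) / z`, used for `z > 0`. -/
def Q (z : ℝ) : ℝ := (xi z - xi 0) / z

/-! ### The coefficients of the expansion -/

/-- The coefficient of `1`. -/
def f0 (a b c : ℝ) : ℝ :=
  1 / (2 * (a * b + b * c + c * a)) *
    (Li3 (Real.exp (-a)) + Li3 (Real.exp (-b)) + Li3 (Real.exp (-c))
      - Li3 (Real.exp (-a - b)) - Li3 (Real.exp (-b - c)) - Li3 (Real.exp (-a - c))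
      + Li3 (Real.exp (-a - b - c)) - (riemannZeta 3).re)

/-- The coefficient of `ε`. -/
def f1 : ℝ := 0

/-- The coefficient of `ε² ln ε`. -/
def f2 (a b c : ℝ) : ℝ := -(1 / (2 * (a * b + b * c + c * a))) * (1 / 12)

/-- The coefficient of `ε²`. -/
def f3 (a b c : ℝ) : ℝ :=
  -(1 / (2 * (a * b + b * c + c * a))) *
    (-(1 / 12) * Real.log
        (((Real.exp a - 1) * (Real.exp b - 1) * (Real.exp c - 1) * (Real.exp (a + b + c) - 1)) /
          ((Real.exp (a + b) - 1) * (Real.exp (b + c) - 1) * (Real.exp (a + c) - 1)))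
      - 1 / 8
      + 1 / 2 * ∫ z in Set.Ioi (0 : ℝ), Real.exp (-z) * Q z)

end

end HexDimer

/-! MacMahon's product formula (`partitionFunction_eq_prod`) makes `ln Z` explicit. Piles are strict
Gelfand–Tsetlin patterns with a fixed top row, and the `q`-sum over such patterns is a constant
multiple of a Vandermonde determinant (`patternSum_eq`). Dividing by the case `K = 0`, where `Z =
1`, removes the constant.

Expanding the logarithms of the product and summing the geometric series over the box gives, for `M
= a/ε`, `N = b/ε`, `K = c/ε`, with `n ≥ 1`, `ε² ln Z = ∑ χ(nε) n⁻³ (1 - e^{-na}) (1 - e^{-nb}) (1 -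
e^{-nc})`. Multiply out the three brackets. In the seven terms that carry an exponential, the Taylor
formula `χ(z) = 1 - z²/12 + O(z³)` may be inserted termwise; it produces trilogarithms and
logarithms with error `O(ε³)` (`exists_hasSum_chi_mul_pow`). The absence of a linear term in `χ` is
why `f₁ = 0`.

The remaining term `∑ χ(nε)/n³` has no such damping. There `χ(z) = 1 - z² e^{-z}/12 + z³ g(z)` with
`g` integrable: the first piece gives `ζ(3)`, the second gives `ε² ln(1 - e^{-ε})/12` and so the `ε²
ln ε` term, and the third is `ε²` times a Riemann sum of `g` (`exists_hasSum_chi`). Integration by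
parts turns `∫ g` into the integral of `e^{-z} Q(z)` (`integral_remainder`). -/

namespace HexDimer
open Finset Matrix

/-! ### Pattern sums as Vandermonde determinants -/

/-- The sum of `q ^ (sum of the entries)` over strict Gelfand–Tsetlin patterns with a given top row
(the top row itself is not counted). -/
noncomputable def patternSum (q : ℝ) : (n : ℕ) → (Fin n → ℕ) → ℝ
  | 0, _ => 1
  | n + 1, l => ∑ m ∈ Fintype.piFinset fun i : Fin n => Ico (l i.castSucc) (l i.succ),
      q ^ (∑ i, m i) * patternSum q n m

/-- Subtracting from each row the one before it turns the column of ones into `(1, 0, …, 0)`; expand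
along that column. -/
theorem det_vandermonde_eq_det_sub {n : ℕ} (x : Fin (n + 1) → ℝ) :
    (vandermonde x).det =
      (of fun i j : Fin n => x i.succ ^ ((j : ℕ) + 1) - x i.castSucc ^ ((j : ℕ) + 1)).det := by
  let B : Matrix (Fin (n + 1)) (Fin (n + 1)) ℝ := of fun i j =>
    Fin.cases (x 0 ^ (j : ℕ)) (fun i' => x i'.succ ^ (j : ℕ) - x i'.castSucc ^ (j : ℕ)) i
  rw [det_eq_of_forall_row_eq_smul_add_pred (B := B) (fun _ => 1), det_succ_column_zero,
    Fin.sum_univ_succ]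
  · simp only [B, of_apply, Fin.cases_succ, Fin.cases_zero, Fin.val_zero, pow_zero, sub_self,
      mul_zero, zero_mul, sum_const_zero, add_zero, mul_one, one_mul]
    congr 1
  · intro j; simp [B, vandermonde_apply]
  · intro i j; simp [B, vandermonde_apply]

/-- The weight raises every exponent of the Vandermonde matrix by one, so row `i` depends on `m i`
only. By multilinearity the sum over the box moves into the rows, each entry becomes a geometric
sum, and the denominators `q ^ (j + 1) - 1` leave by columns. -/
theorem sum_pow_mul_det_vandermonde {q : ℝ} (hq0 : 0 < q) (hq1 : q < 1) {n : ℕ}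
    {l : Fin (n + 1) → ℕ} (hl : StrictMono l) :
    ∑ m ∈ Fintype.piFinset fun i : Fin n => Ico (l i.castSucc) (l i.succ),
      q ^ (∑ i, m i) * (vandermonde fun i => q ^ m i).det =
    (∏ j : Fin n, (q ^ ((j : ℕ) + 1) - 1)⁻¹) * (vandermonde fun i => q ^ l i).det := by
  have h1 : ∀ m : Fin n → ℕ, q ^ (∑ i, m i) * (vandermonde fun i => q ^ m i).det =
      detRowAlternating.toMultilinearMap (fun i => fun j : Fin n => (q ^ ((j : ℕ) + 1)) ^ m i) := by
    intro m
    rw [← prod_pow_eq_pow_sum, ← det_mul_column]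
    change _ = det _
    congr 1
    ext i j
    simp only [of_apply, vandermonde_apply]
    ring
  simp_rw [h1]
  rw [← MultilinearMap.map_sum_finset (detRowAlternating (R := ℝ) (n := Fin n)).toMultilinearMap
    (fun i (k : ℕ) => fun j : Fin n => (q ^ ((j : ℕ) + 1)) ^ k), det_vandermonde_eq_det_sub,
    ← det_mul_row]
  change det _ = _
  congr 1
  ext i j
  have hne : q ^ ((j : ℕ) + 1) ≠ 1 := (pow_lt_one₀ hq0.le hq1 (by omega)).ne
  rw [Finset.sum_apply, geom_sum_Ico hne (hl i.castSucc_lt_succ).le]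
  simp only [of_apply]
  rw [div_eq_inv_mul]
  ring

/-- The constant may stay implicit, since it cancels when two top rows are compared. The half-open
intervals of the interlacing keep the next row strictly increasing, as the induction requires. -/
theorem patternSum_eq {q : ℝ} (hq0 : 0 < q) (hq1 : q < 1) (n : ℕ) :
    ∃ c : ℝ, ∀ l : Fin n → ℕ, StrictMono l →
      patternSum q n l = c * (vandermonde fun i => q ^ l i).det := by
  induction n with
  | zero => exact ⟨1, fun l _ => by simp [patternSum]⟩
  | succ n ih =>
    obtain ⟨c, hc⟩ := ih
    refine ⟨c * ∏ j : Fin n, (q ^ ((j : ℕ) + 1) - 1)⁻¹, fun l hl => ?_⟩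
    rw [patternSum, mul_assoc, ← sum_pow_mul_det_vandermonde hq0 hq1 hl, mul_sum]
    refine sum_congr rfl fun m hm => ?_
    rw [hc m, mul_left_comm]
    rw [Fintype.mem_piFinset] at hm
    cases n with
    | zero => exact fun i => i.elim0
    | succ n =>
      refine Fin.strictMono_iff_lt_succ.2 fun i => ?_
      have h1 := mem_Ico.1 (hm i.castSucc)
      have h2 := mem_Ico.1 (hm i.succ)
      rw [← Fin.succ_castSucc] at h2
      exact h1.2.trans_le h2.1

/-! ### The bijection between patterns and piles -/

/-- Strict Gelfand–Tsetlin patterns of order `n` with top row `l`, as arrays on the triangle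
`s + t < n` whose hypotenuse is `l`. -/
def IsPattern (n : ℕ) (l : Fin n → ℕ) (y : ℕ → ℕ → ℕ) : Prop :=
  (∀ s t, s + t + 1 < n → y (s + 1) t ≤ y s t ∧ y s t < y s (t + 1)) ∧
    (∀ (s : ℕ) (t : Fin n), s + t + 1 = n → y s t = l t) ∧ ∀ s t, n ≤ s + t → y s t = 0

/-- Unfolds the recursion into one sum over arrays. The exponent runs over the diagonals `s + t = r`
with `r < n - 1`, thus omitting the top row. -/
theorem exists_patternSum_eq_sum (q : ℝ) (n : ℕ) (l : Fin n → ℕ) :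
    ∃ F : Finset (ℕ → ℕ → ℕ), (∀ y, y ∈ F ↔ IsPattern n l y) ∧
      patternSum q n l = ∑ y ∈ F, q ^ (∑ r ∈ range (n - 1), ∑ t ∈ range (r + 1), y (r - t) t) := by
  induction n with
  | zero =>
    refine ⟨{fun _ _ => 0}, fun y => ?_, by simp [patternSum]⟩
    simp only [mem_singleton, IsPattern]
    constructor
    · rintro rfl
      exact ⟨fun s t h => by omega, fun s t => t.elim0, fun _ _ _ => rfl⟩
    · rintro ⟨-, -, h⟩
      ext s t
      exact h s t (Nat.zero_le _)
  | succ n ih =>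
    classical
    choose F hF hs using ih
    -- `e` adds the new top row on the diagonal `s + t = n`, where a smaller pattern vanishes; hence
    -- it is injective on patterns.
    let e : (ℕ → ℕ → ℕ) → ℕ → ℕ → ℕ := fun y s t =>
      if h : s + t = n then l ⟨t, by omega⟩ else y s t
    have he : ∀ y s t, s + t ≠ n → e y s t = y s t := fun y s t h => dif_neg h
    have he' : ∀ y s (t : Fin (n + 1)), s + t = n → e y s t = l t := fun y s t h => dif_pos h
    have hinj : ∀ m y, IsPattern n m y → ∀ m' y', IsPattern n m' y' → e y = e y' → y = y' := by
      intro m y hy m' y' hy' h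
      ext s t
      by_cases hst : s + t = n
      · rw [hy.2.2 s t hst.ge, hy'.2.2 s t hst.ge]
      · rw [← he y s t hst, h, he y' s t hst]
    have hrow : ∀ m y, IsPattern n m y → ∀ t : Fin n, y (n - 1 - t) t = m t :=
      fun m y hy t => hy.2.1 _ t (by omega)
    refine ⟨(Fintype.piFinset fun i : Fin n => Ico (l i.castSucc) (l i.succ)).biUnion
      fun m => (F m).image e, fun y => ?_, ?_⟩
    · simp only [mem_biUnion, mem_image, Fintype.mem_piFinset, mem_Ico, hF]
      constructor
      · rintro ⟨m, hm, z, hz, rfl⟩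
        refine ⟨fun s t hst => ?_, fun s t hst => he' z s t (by omega), fun s t hst => ?_⟩
        · rw [he z s t (by omega)]
          by_cases h : s + t + 1 = n
          · have h1 := he' z (s + 1) ⟨t, by omega⟩ (by simp only; omega)
            have h2 := he' z s ⟨t + 1, by omega⟩ (by simp only; omega)
            simp only at h1 h2
            rw [h1, h2]
            have h3 := hz.2.1 s ⟨t, by omega⟩ h
            simp only at h3
            rw [h3]
            exact hm ⟨t, by omega⟩
          · rw [he z (s + 1) t (by omega), he z s (t + 1) (by omega)]
            exact hz.1 s t (by omega)
        · rw [he z s t (by omega)]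
          exact hz.2.2 s t (by omega)
      · rintro ⟨h1, h2, h3⟩
        refine ⟨fun t => y (n - 1 - t) t, fun t => ?_,
          fun s t => if s + t = n then 0 else y s t, ⟨?_, ?_, ?_⟩, ?_⟩
        · have ht := t.2
          have := h1 (n - 1 - t) t (by omega)
          rw [← h2 (n - 1 - t + 1) t.castSucc (by simp only [Fin.val_castSucc]; omega),
            ← h2 (n - 1 - t) t.succ (by simp only [Fin.val_succ]; omega)]
          exact this
        · intro s t hst
          beta_reduce
          rw [if_neg (by omega), if_neg (by omega), if_neg (by omega)]
          exact h1 s t (by omega)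
        · intro s t hst
          beta_reduce
          rw [if_neg (by omega)]
          congr 1; omega
        · intro s t hst
          beta_reduce
          split_ifs with h
          · rfl
          · exact h3 s t (by omega)
        · ext s t
          by_cases h : s + t = n
          · have h4 := he' (fun s t => if s + t = n then 0 else y s t) s ⟨t, by omega⟩ h
            simp only at h4
            rw [h4]
            exact (h2 s ⟨t, by omega⟩ (by simp only; omega)).symm
          · exact (he (fun s t => if s + t = n then 0 else y s t) s t h).trans (if_neg h)
    · rw [sum_biUnion, patternSum]
      · refine sum_congr rfl fun m hm => ?_
        rw [sum_image, hs, mul_sum]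
        · refine sum_congr rfl fun y hy => ?_
          rw [hF] at hy
          rw [← pow_add]
          congr 1
          have key : ∀ k ≤ n, ∑ r ∈ range k, ∑ t ∈ range (r + 1), e y (r - t) t =
              ∑ r ∈ range k, ∑ t ∈ range (r + 1), y (r - t) t := fun k hk =>
            sum_congr rfl fun r hr => sum_congr rfl fun t ht => he _ _ _ (by
              rw [mem_range] at hr ht; omega)
          rw [Nat.add_sub_cancel, key n le_rfl]
          cases n with
          | zero => simp
          | succ n =>
            rw [Nat.add_sub_cancel, sum_range_succ _ n, add_comm]
            congr 1
            rw [← Fin.sum_univ_eq_sum_range (fun t => y (n - t) t)]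
            exact sum_congr rfl fun t _ => (hrow m y hy t).symm
        · intro y hy y' hy' h
          exact hinj m y ((hF _ _).1 hy) m y' ((hF _ _).1 hy') h
      · intro m _ m' _ hne
        refine disjoint_left.2 fun z hz hz' => hne ?_
        obtain ⟨y, hy, rfl⟩ := mem_image.1 hz
        obtain ⟨y', hy', h⟩ := mem_image.1 hz'
        rw [hF] at hy hy'
        obtain rfl := hinj _ _ hy' _ _ hy h
        ext t
        rw [← hrow m _ hy t, ← hrow m' _ hy' t]

/-- The top row of the patterns that encode piles of cubes. -/
def topRow (N K t : ℕ) : ℕ := if t < N then t else t + K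

/-- The heights of a pile, extended by the forced values `0` and `K`. -/
def extendedHeight {M N K : ℕ} (h : Fin M → Fin N → Fin (K + 1)) (s t : ℕ) : ℕ :=
  if hst : s < M ∧ t < N then h ⟨s, hst.1⟩ ⟨N - 1 - t, by omega⟩ else if t < N then 0 else K

/-- The pattern that encodes a pile. -/
def toPattern {M N K : ℕ} (h : Fin M → Fin N → Fin (K + 1)) (s t : ℕ) : ℕ :=
  if s + t < M + N then t + extendedHeight h s t else 0

/-- The pile encoded by a pattern. -/
def ofPattern (M N K : ℕ) (y : ℕ → ℕ → ℕ) (i : Fin M) (j : Fin N) : Fin (K + 1) :=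
  ⟨min (y i (N - 1 - j) - (N - 1 - j)) K, by omega⟩

/-- Walk from `(s, t)` to the hypotenuse: entries weakly decrease in `s` and increase by at least
one per step in `t`. -/
theorem IsPattern.le_apply {n : ℕ} {L : ℕ → ℕ} {y : ℕ → ℕ → ℕ}
    (hy : IsPattern n (fun t => L t) y) (d : ℕ) :
    ∀ s t, s + t + 1 + d = n → L t ≤ y s t ∧ y s t + d ≤ L (t + d) := by
  induction d with
  | zero =>
    intro s t h
    have := hy.2.1 s ⟨t, by omega⟩ h
    simp only at this
    simp [this]
  | succ d ih =>
    intro s t h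
    have h1 := hy.1 s t (by omega)
    have h2 := ih (s + 1) t (by omega)
    have h3 := ih s (t + 1) (by omega)
    rw [show t + 1 + d = t + (d + 1) by omega] at h3
    omega

/-- For this top row the entries outside the rectangle `s < M`, `t < N` are forced; the free ones,
less `t`, are the heights of a pile. -/
theorem IsPattern.bounds {M N K : ℕ} {y : ℕ → ℕ → ℕ}
    (hy : IsPattern (M + N) (fun t => topRow N K t) y) {s t : ℕ} (hst : s + t < M + N) :
    t ≤ y s t ∧ y s t ≤ t + K ∧ (M ≤ s → y s t = t) ∧ (N ≤ t → y s t = t + K) := by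
  have h := hy.le_apply (M + N - 1 - s - t) s t (by omega)
  unfold topRow at h
  split_ifs at h <;> omega

theorem isPattern_toPattern {M N K : ℕ} {h : Fin M → Fin N → Fin (K + 1)} (hh : IsConfig h) :
    IsPattern (M + N) (fun t => topRow N K t) (toPattern h) := by
  refine ⟨fun s t hst => ?_, fun s t hst => ?_, fun s t hst => if_neg (by omega)⟩
  · rw [toPattern, toPattern, toPattern, if_pos (by omega), if_pos (by omega), if_pos (by omega)]
    have h1 : extendedHeight h (s + 1) t ≤ extendedHeight h s t := by
      unfold extendedHeight
      split_ifs
      · exact hh.1 _ _ _ rfl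
      all_goals omega
    have h2 : extendedHeight h s t ≤ extendedHeight h s (t + 1) := by
      unfold extendedHeight
      split_ifs
      · exact hh.2 _ _ _ (by simp only; omega)
      all_goals omega
    omega
  · rw [toPattern, if_pos (by omega)]
    simp only [extendedHeight, topRow]
    split_ifs <;> omega

theorem isConfig_ofPattern {M N K : ℕ} {y : ℕ → ℕ → ℕ}
    (hy : IsPattern (M + N) (fun t => topRow N K t) y) : IsConfig (ofPattern M N K y) := by
  refine ⟨fun i i' j h => ?_, fun i j j' h => ?_⟩ <;>
    simp only [ofPattern, Fin.mk_le_mk]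
  · have := hy.1 i' (N - 1 - j) (by omega)
    rw [h] at this
    omega
  · have := hy.1 i (N - 1 - j) (by omega)
    rw [show N - 1 - (j : ℕ) + 1 = N - 1 - j' by omega] at this
    omega

theorem ofPattern_toPattern {M N K : ℕ} (h : Fin M → Fin N → Fin (K + 1)) :
    ofPattern M N K (toPattern h) = h := by
  ext i j
  have hj : (⟨N - 1 - (N - 1 - (j : ℕ)), by omega⟩ : Fin N) = j := Fin.ext (by simp only; omega)
  simp only [ofPattern, toPattern, extendedHeight]
  rw [if_pos (by omega), dif_pos ⟨i.2, by omega⟩, hj]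
  have := (h i j).2
  simp only [Fin.eta]
  omega

theorem toPattern_ofPattern {M N K : ℕ} {y : ℕ → ℕ → ℕ}
    (hy : IsPattern (M + N) (fun t => topRow N K t) y) : toPattern (ofPattern M N K y) = y := by
  ext s t
  by_cases hst : s + t < M + N
  · have h := hy.bounds hst
    rw [toPattern, if_pos hst, extendedHeight]
    split_ifs with h1 h2
    · simp only [ofPattern]
      rw [show N - 1 - (N - 1 - t) = t by omega]
      omega
    all_goals omega
  · rw [toPattern, if_neg hst, hy.2.2 s t (by omega)]

/-- The columns `t ≥ N` contribute forced copies of `K`. Their number is written as a count of pairs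
`u < j` to match the power of `q` in `det_vandermonde_topRow`. -/
theorem sum_extendedHeight {M N K : ℕ} (h : Fin (M + 1) → Fin N → Fin (K + 1)) :
    ∑ t ∈ range (N + M), ∑ s ∈ range (N + M - t), extendedHeight h s t =
      volume h + ∑ u ∈ range (M + 1), ∑ j ∈ range (M + 1), if u < j then K else 0 := by
  rw [sum_range_add]
  congr 1
  · have h1 : ∀ t ∈ range N, ∑ s ∈ range (N + M - t), extendedHeight h s t =
        ∑ s ∈ range (M + 1), extendedHeight h s t := by
      intro t ht
      rw [mem_range] at ht
      refine (sum_subset (range_subset_range.2 (by omega)) fun s _ hs => ?_).symm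
      rw [mem_range] at hs
      rw [extendedHeight, dif_neg (by omega), if_pos ht]
    rw [sum_congr rfl h1, ← sum_range_reflect, sum_comm, sum_range, volume]
    refine sum_congr rfl fun i _ => ?_
    rw [sum_range]
    refine sum_congr rfl fun j _ => ?_
    have hj : (⟨N - 1 - (N - 1 - (j : ℕ)), by omega⟩ : Fin N) = j := Fin.ext (by simp only; omega)
    rw [extendedHeight, dif_pos ⟨i.2, by omega⟩, hj]
  · rw [sum_range_succ _ M]
    have h0 : (∑ j ∈ range (M + 1), if M < j then K else 0) = 0 :=
      sum_eq_zero fun j hj => if_neg (by rw [mem_range] at hj; omega)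
    rw [h0, add_zero]
    refine sum_congr rfl fun u hu => ?_
    rw [← sum_filter, sum_congr rfl (g := fun _ => K), sum_const, sum_const]
    · congr 1
      rw [card_range, show (range (M + 1)).filter (fun j => u < j) = Ioo u (M + 1) by
        ext j; simp [and_comm], Nat.card_Ioo]
      omega
    · intro s _
      rw [extendedHeight, dif_neg (by omega), if_neg (by omega)]

theorem patternSum_topRow (q : ℝ) (M N K : ℕ) :
    patternSum q (M + 1 + N) (fun t => topRow N K t) =
      q ^ (∑ t ∈ range (N + M), ∑ _s ∈ range (N + M - t), t) *
        (q ^ (∑ u ∈ range (M + 1), ∑ j ∈ range (M + 1), if u < j then K else 0) *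
          partitionFunction (M + 1) N K q) := by
  classical
  obtain ⟨F, hF, hs⟩ := exists_patternSum_eq_sum q (M + 1 + N) (fun t => topRow N K t)
  rw [hs, partitionFunction, mul_sum, mul_sum]
  symm
  refine sum_bij' (fun h _ => toPattern h) (fun y _ => ofPattern _ _ _ y) ?_ ?_ ?_ ?_ ?_
  · intro h hh
    rw [hF]
    exact isPattern_toPattern (mem_filter.1 hh).2
  · intro y hy
    exact mem_filter.2 ⟨mem_univ _, isConfig_ofPattern ((hF _).1 hy)⟩
  · intro h _
    exact ofPattern_toPattern h
  · intro y hy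
    exact toPattern_ofPattern ((hF _).1 hy)
  · intro h _
    rw [← pow_add, ← pow_add]
    congr 1
    rw [sum_range_diag_flip _ (fun t s => toPattern h s t),
      show M + 1 + N - 1 = N + M by omega, add_comm _ (volume h), ← sum_extendedHeight,
      ← sum_add_distrib]
    refine sum_congr rfl fun t ht => ?_
    rw [← sum_add_distrib]
    refine sum_congr rfl fun s hs' => ?_
    rw [mem_range] at hs'
    rw [toPattern, if_pos (by omega)]

/-! ### MacMahon's product formula -/

theorem partitionFunction_zero (M N : ℕ) (q : ℝ) : partitionFunction M N 0 q = 1 := by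
  classical
  rw [partitionFunction, sum_eq_single (fun _ _ => 0)]
  · simp [volume]
  · intro h _ hne
    exact absurd (funext fun i => funext fun j => Fin.ext (by omega)) hne
  · intro h
    refine absurd (mem_filter.2 ⟨mem_univ _, ?_⟩) h
    exact ⟨fun _ _ _ _ => le_rfl, fun _ _ _ _ => le_rfl⟩

theorem topRow_strictMono (N K : ℕ) : StrictMono (topRow N K) := by
  intro s t hst
  unfold topRow
  split_ifs <;> omega

/-- Pairs of indices split into both below `N`, mixed, and both from `N` on. Apart from an explicit
power of `q`, only the mixed factor depends on `K`. -/
theorem det_vandermonde_topRow (q : ℝ) (M N K : ℕ) :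
    (vandermonde fun i : Fin (M + N) => q ^ topRow N K i).det =
      (∏ i ∈ range N, ∏ j ∈ range N, if i < j then q ^ j - q ^ i else 1) *
      (∏ i ∈ range N, ∏ j ∈ range M, (q ^ (N + j + K) - q ^ i)) *
      (q ^ (∑ i ∈ range M, ∑ j ∈ range M, if i < j then K else 0) *
        ∏ i ∈ range M, ∏ j ∈ range M, if i < j then q ^ (N + j) - q ^ (N + i) else 1) := by
  have h1 : (vandermonde fun i : Fin (M + N) => q ^ topRow N K i).det =
      ∏ i ∈ range (N + M), ∏ j ∈ range (N + M),
        if i < j then q ^ topRow N K j - q ^ topRow N K i else 1 := by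
    rw [det_vandermonde, add_comm N M, ← Fin.prod_univ_eq_prod_range]
    refine prod_congr rfl fun i _ => ?_
    rw [← Fin.prod_univ_eq_prod_range
      (fun j => if (i : ℕ) < j then q ^ topRow N K j - q ^ topRow N K i else 1), ← prod_filter]
    refine prod_congr ?_ fun _ _ => rfl
    ext j
    simp
  rw [h1, prod_range_add, mul_assoc, ← prod_pow_eq_pow_sum, ← prod_mul_distrib]
  simp only [← prod_pow_eq_pow_sum, ← prod_mul_distrib]
  rw [← mul_assoc, ← prod_mul_distrib]
  congr 1
  · refine prod_congr rfl fun i hi => ?_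
    rw [mem_range] at hi
    rw [prod_range_add]
    congr 1
    · refine prod_congr rfl fun j hj => ?_
      rw [mem_range] at hj
      simp [topRow, hi, hj]
    · refine prod_congr rfl fun j hj => ?_
      rw [if_pos (by omega)]
      simp [topRow, hi]
  · refine prod_congr rfl fun i hi => ?_
    rw [prod_range_add, prod_eq_one, one_mul]
    · refine prod_congr rfl fun j hj => ?_
      simp only [topRow, add_lt_add_iff_left, Nat.not_lt.2 (Nat.le_add_right _ _), if_false]
      split_ifs
      · ring
      · simp
    · intro j hj
      rw [mem_range] at hj
      rw [if_neg (by omega)]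

/-- MacMahon's formula for the generating function of boxed plane partitions. -/
theorem partitionFunction_eq_prod {q : ℝ} (hq0 : 0 < q) (hq1 : q < 1) {M : ℕ} (hM : 0 < M)
    (N K : ℕ) :
    partitionFunction M N K q =
      ∏ i ∈ range N, ∏ j ∈ range M, (1 - q ^ (i + j + 1 + K)) / (1 - q ^ (i + j + 1)) := by
  obtain ⟨M, rfl⟩ : ∃ M', M = M' + 1 := ⟨M - 1, by omega⟩
  obtain ⟨c, hc⟩ := patternSum_eq hq0 hq1 (M + 1 + N)
  have hmono : ∀ K, StrictMono fun t : Fin (M + 1 + N) => topRow N K t := fun K =>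
    (topRow_strictMono N K).comp Fin.val_strictMono
  have hK := hc _ (hmono K)
  have h0 := hc _ (hmono 0)
  rw [patternSum_topRow, det_vandermonde_topRow] at hK h0
  rw [partitionFunction_zero] at h0
  simp only [ite_self, sum_const_zero, pow_zero, mul_one, one_mul, add_zero] at h0
  set A := ∏ i ∈ range N, ∏ j ∈ range N, if i < j then q ^ j - q ^ i else 1
  set B := ∏ i ∈ range (M + 1), ∏ j ∈ range (M + 1),
    if i < j then q ^ (N + j) - q ^ (N + i) else 1
  set W := ∑ t ∈ range (N + M), ∑ _s ∈ range (N + M - t), t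
  set W' := ∑ u ∈ range (M + 1), ∑ j ∈ range (M + 1), if u < j then K else 0
  have hW : 0 < q ^ W := pow_pos hq0 _
  have hW' : 0 < q ^ W' := pow_pos hq0 _
  have h2 : (∏ i ∈ range N, ∏ j ∈ range (M + 1), (q ^ (N + j) - q ^ i)) *
      partitionFunction (M + 1) N K q =
      ∏ i ∈ range N, ∏ j ∈ range (M + 1), (q ^ (N + j + K) - q ^ i) := by
    -- By the case `K = 0`, this product divides the nonzero number `q ^ W`.
    have h3 : c * A * B ≠ 0 := by
      intro h
      apply hW.ne'
      rw [h0]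
      linear_combination (∏ i ∈ range N, ∏ j ∈ range (M + 1), (q ^ (N + j) - q ^ i)) * h
    have h4 := mul_left_cancel₀ hW'.ne' (show q ^ W' * (q ^ W * partitionFunction (M + 1) N K q) =
      q ^ W' * (c * A * B * ∏ i ∈ range N, ∏ j ∈ range (M + 1), (q ^ (N + j + K) - q ^ i)) by
        linear_combination hK)
    rw [h0] at h4
    refine mul_left_cancel₀ h3 ?_
    linear_combination h4
  have hne : ∀ i ∈ range N, ∀ j, q ^ (N + j) - q ^ i ≠ 0 := by
    intro i hi j
    rw [mem_range] at hi
    exact (sub_neg.2 (pow_lt_pow_right_of_lt_one₀ hq0 hq1 (by omega))).ne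
  rw [(eq_div_iff (prod_ne_zero_iff.2 fun i hi => prod_ne_zero_iff.2 fun j _ =>
    hne i hi j)).2 ((mul_comm _ _).trans h2), ← prod_div_distrib, ← prod_range_reflect]
  refine prod_congr rfl fun i hi => ?_
  rw [← prod_div_distrib]
  refine prod_congr rfl fun j _ => ?_
  have hi' := mem_range.1 hi
  -- After the reflection `i ↦ N - 1 - i`, numerator and denominator share the factor `-q ^ (N - 1 -
  -- i)`.
  have e1 : q ^ (N + j + K) = q ^ (N - 1 - i) * q ^ (i + j + 1 + K) := by
    rw [← pow_add]; congr 1; omega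
  have e2 : q ^ (N + j) = q ^ (N - 1 - i) * q ^ (i + j + 1) := by
    rw [← pow_add]; congr 1; omega
  have e3 : ∀ x : ℝ, q ^ (N - 1 - i) * x - q ^ (N - 1 - i) = -q ^ (N - 1 - i) * (1 - x) :=
    fun x => by ring
  rw [e1, e2, e3, e3, mul_div_mul_left]
  exact neg_ne_zero.2 (pow_pos hq0 _).ne'
end HexDimer

/-! ### Analyticity and Taylor expansion of `χ` -/

namespace HexDimer
open Set Filter Topology MeasureTheory

theorem analyticAt_dslope_zero {f : ℝ → ℝ} (hf : ∀ z, AnalyticAt ℝ f z) (z : ℝ) :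
    AnalyticAt ℝ (dslope f 0) z := by
  rcases eq_or_ne z 0 with rfl | hz
  · obtain ⟨p, hp⟩ := hf 0
    exact hp.has_fpower_series_dslope_fslope.analyticAt
  · have h : AnalyticAt ℝ (fun x => x⁻¹ * (f x - f 0)) z :=
      (analyticAt_id.inv hz).mul ((hf z).sub analyticAt_const)
    refine h.congr ?_
    filter_upwards [isOpen_ne.mem_nhds hz] with x hx
    rw [dslope_of_ne f hx, slope_def_field, sub_zero, div_eq_inv_mul]

theorem exists_eq_mul_of_apply_zero {f : ℝ → ℝ} (hf : ∀ z, AnalyticAt ℝ f z) (h0 : f 0 = 0) :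
    ∃ g : ℝ → ℝ, (∀ z, AnalyticAt ℝ g z) ∧ ∀ z, f z = z * g z := by
  refine ⟨dslope f 0, analyticAt_dslope_zero hf, fun z => ?_⟩
  have := sub_smul_dslope f 0 z
  rw [sub_zero, h0, sub_zero, smul_eq_mul] at this
  exact this.symm

theorem deriv_id_mul {g : ℝ → ℝ} (hg : ∀ z, AnalyticAt ℝ g z) :
    deriv (fun z => z * g z) = fun z => g z + z * deriv g z := by
  ext z
  have := (hasDerivAt_id z).mul (hg z).differentiableAt.hasDerivAt
  simp only [one_mul] at this
  exact this.deriv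

/-- Divide out `z` three times; the vanishing derivatives supply the zero at each stage. -/
theorem exists_eq_cube_mul {f : ℝ → ℝ} (hf : ∀ z, AnalyticAt ℝ f z) (h0 : f 0 = 0)
    (h1 : deriv f 0 = 0) (h2 : deriv (deriv f) 0 = 0) :
    ∃ g : ℝ → ℝ, (∀ z, AnalyticAt ℝ g z) ∧ ∀ z, f z = z ^ 3 * g z := by
  obtain ⟨g₁, hg₁, e₁⟩ := exists_eq_mul_of_apply_zero hf h0
  have d₁ : deriv f = fun z => g₁ z + z * deriv g₁ z := by
    rw [funext e₁, deriv_id_mul hg₁]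
  have z₁ : g₁ 0 = 0 := by simpa [d₁] using h1
  obtain ⟨g₂, hg₂, e₂⟩ := exists_eq_mul_of_apply_zero hg₁ z₁
  have d₂ : deriv g₁ = fun z => g₂ z + z * deriv g₂ z := by
    rw [funext e₂, deriv_id_mul hg₂]
  have z₂ : g₂ 0 = 0 := by
    have h3 : HasDerivAt (fun z => g₁ z + z * deriv g₁ z) (deriv g₁ 0 + (1 * deriv g₁ 0 +
        0 * deriv (deriv g₁) 0)) 0 :=
      (hg₁ 0).differentiableAt.hasDerivAt.add
        ((hasDerivAt_id 0).mul (hg₁ 0).deriv.differentiableAt.hasDerivAt)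
    rw [d₁, h3.deriv, d₂] at h2
    simpa using h2
  obtain ⟨g₃, hg₃, e₃⟩ := exists_eq_mul_of_apply_zero hg₂ z₂
  exact ⟨g₃, hg₃, fun z => by rw [e₁, e₂, e₃]; ring⟩

theorem hasDerivAt_exp_neg (z : ℝ) : HasDerivAt (fun z => Real.exp (-z)) (-Real.exp (-z)) z := by
  simpa using (hasDerivAt_neg z).exp

theorem analyticAt_exp_neg (z : ℝ) : AnalyticAt ℝ (fun z => Real.exp (-z)) z :=
  analyticAt_id.neg.rexp

/-- `χ` is analytic, with the Taylor expansion `1 - z² / 12 + O(z³)` at `0`. -/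
theorem analyticAt_chi_and_taylor :
    (∀ z, AnalyticAt ℝ chi z) ∧ deriv chi 0 = 0 ∧ deriv (deriv chi) 0 = -(1 / 6) := by
  -- With `1 - e^{-z} = z w(z)` and `w` without zeros, `χ = e^{-z} / w²` is analytic. Its
  -- derivatives at `0` come from differentiating `e^{-z} = χ w²`, those of `w` from differentiating
  -- `z w`.
  obtain ⟨w, hw, ew⟩ := exists_eq_mul_of_apply_zero (f := fun z => 1 - Real.exp (-z))
    (fun z => analyticAt_const.sub (analyticAt_exp_neg z)) (by simp)
  have hw' : ∀ z, AnalyticAt ℝ (deriv w) z := fun z => (hw z).deriv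
  have hw'' : ∀ z, AnalyticAt ℝ (deriv (deriv w)) z := fun z => (hw' z).deriv
  have D : ∀ {f : ℝ → ℝ}, (∀ z, AnalyticAt ℝ f z) → ∀ z, HasDerivAt f (deriv f z) z :=
    fun h z => (h z).differentiableAt.hasDerivAt
  have e₁ : ∀ z, Real.exp (-z) = w z + z * deriv w z := by
    intro z
    have h1 := (hasDerivAt_exp_neg z).const_sub 1
    have h2 := (hasDerivAt_id z).mul (D hw z)
    rw [funext ew] at h1
    have := h1.unique h2
    simpa using this
  have e₂ : ∀ z, -Real.exp (-z) = 2 * deriv w z + z * deriv (deriv w) z := by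
    intro z
    have h1 := hasDerivAt_exp_neg z
    have h2 := (D hw z).add ((hasDerivAt_id z).mul (D hw' z))
    rw [funext e₁] at h1
    have := h1.unique h2
    simp only [id, one_mul] at this
    linarith
  have e₃ : Real.exp (-0) = 3 * deriv (deriv w) 0 := by
    have h1 := (hasDerivAt_exp_neg 0).neg
    have h2 := ((D hw' 0).const_mul 2).add ((hasDerivAt_id 0).mul (D hw'' 0))
    rw [show (-fun z : ℝ => Real.exp (-z)) = fun z => 2 * deriv w z + z * deriv (deriv w) z from
      funext e₂] at h1
    have := h1.unique h2
    simp only [id, one_mul, zero_mul] at this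
    linarith
  have w₀ : w 0 = 1 := by simpa using (e₁ 0).symm
  have w₁ : deriv w 0 = -(1 / 2) := by
    have := e₂ 0
    simp only [neg_zero, Real.exp_zero, zero_mul] at this
    linarith
  have w₂ : deriv (deriv w) 0 = 1 / 3 := by
    simp only [neg_zero, Real.exp_zero] at e₃
    linarith
  have wne : ∀ z, w z ≠ 0 := by
    intro z hz
    have := ew z
    rw [hz, mul_zero, sub_eq_zero] at this
    have h0 : z = 0 := by simpa using this.symm
    rw [h0, w₀] at hz
    exact one_ne_zero hz
  have hchi : chi = fun z => Real.exp (-z) / w z ^ 2 := by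
    ext z
    unfold chi
    split_ifs with h
    · simp [h, w₀]
    · rw [ew z, div_mul_cancel_left₀ h, inv_pow, div_eq_mul_inv]
  have ha : ∀ z, AnalyticAt ℝ chi z := by
    intro z
    rw [hchi]
    exact (analyticAt_exp_neg z).div ((hw z).pow 2) (pow_ne_zero 2 (wne z))
  have ha' : ∀ z, AnalyticAt ℝ (deriv chi) z := fun z => (ha z).deriv
  have c₀ : chi 0 = 1 := by simp [chi]
  have f₀ : ∀ z, Real.exp (-z) = chi z * w z ^ 2 := by
    intro z
    rw [hchi]
    field_simp [wne z]
  have f₁ : ∀ z, -Real.exp (-z) = deriv chi z * w z ^ 2 + chi z * (2 * w z * deriv w z) := by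
    intro z
    have h1 := hasDerivAt_exp_neg z
    have h2 := (D ha z).mul ((D hw z).pow 2)
    rw [funext f₀] at h1
    have := h1.unique h2
    simpa using this
  have f₂ : Real.exp (-0) = deriv (deriv chi) 0 * w 0 ^ 2 + deriv chi 0 * (2 * w 0 * deriv w 0) +
      (deriv chi 0 * (2 * w 0 * deriv w 0) + chi 0 * (2 * deriv w 0 * deriv w 0 +
        2 * w 0 * deriv (deriv w) 0)) := by
    have h1 := (hasDerivAt_exp_neg 0).neg
    have h2 := ((D ha' 0).mul ((D hw 0).pow 2)).add
      ((D ha 0).mul (((D hw 0).const_mul 2).mul (D hw' 0)))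
    rw [show (-fun z : ℝ => Real.exp (-z)) = fun z => deriv chi z * w z ^ 2 +
      chi z * (2 * w z * deriv w z) from funext f₁] at h1
    have := h1.unique h2
    simpa using this
  have c₁ : deriv chi 0 = 0 := by
    have := f₁ 0
    simp only [neg_zero, Real.exp_zero, w₀, w₁, c₀] at this
    linarith
  refine ⟨ha, c₁, ?_⟩
  simp only [neg_zero, Real.exp_zero, w₀, w₁, w₂, c₀, c₁] at f₂
  linarith

theorem hasDerivAt_sq_mul_exp_neg (z : ℝ) :
    HasDerivAt (fun z => z ^ 2 * Real.exp (-z)) ((2 * z - z ^ 2) * Real.exp (-z)) z := by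
  refine ((hasDerivAt_pow 2 z).mul (hasDerivAt_exp_neg z)).congr_deriv ?_
  push_cast
  ring

theorem hasDerivAt_sub_sq_mul_exp_neg (z : ℝ) :
    HasDerivAt (fun z => (2 * z - z ^ 2) * Real.exp (-z))
      ((2 - 4 * z + z ^ 2) * Real.exp (-z)) z := by
  refine ((((hasDerivAt_id z).const_mul 2).sub (hasDerivAt_pow 2 z)).mul
    (hasDerivAt_exp_neg z)).congr_deriv ?_
  simp only [id, Pi.sub_apply]
  push_cast
  ring

/-- The factor `e^{-z}` on the quadratic term leaves the expansion to second order unchanged, but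
makes `z³ g` bounded at infinity, so that `g` is integrable. -/
theorem exists_chi_eq : ∃ g : ℝ → ℝ, (∀ z, AnalyticAt ℝ g z) ∧
    ∀ z, chi z = 1 - z ^ 2 * Real.exp (-z) / 12 + z ^ 3 * g z := by
  obtain ⟨ha, c₁, c₂⟩ := analyticAt_chi_and_taylor
  have d₁ : deriv (fun z => chi z - 1 + z ^ 2 * Real.exp (-z) / 12) =
      fun z => deriv chi z + (2 * z - z ^ 2) * Real.exp (-z) / 12 := by
    ext z
    exact (((ha z).differentiableAt.hasDerivAt.sub_const 1).add
      ((hasDerivAt_sq_mul_exp_neg z).div_const 12)).deriv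
  have d₂ : deriv (fun z => deriv chi z + (2 * z - z ^ 2) * Real.exp (-z) / 12) =
      fun z => deriv (deriv chi) z + (2 - 4 * z + z ^ 2) * Real.exp (-z) / 12 := by
    ext z
    exact ((ha z).deriv.differentiableAt.hasDerivAt.add
      ((hasDerivAt_sub_sq_mul_exp_neg z).div_const 12)).deriv
  obtain ⟨g, hg, e⟩ := exists_eq_cube_mul (f := fun z => chi z - 1 + z ^ 2 * Real.exp (-z) / 12)
    (fun z => ((ha z).sub analyticAt_const).add
      (((analyticAt_id.pow 2).mul (analyticAt_exp_neg z)).div_const))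
    (by simp [chi]) (by simp [d₁, c₁]) (by rw [d₁, d₂]; simp [c₂]; norm_num)
  exact ⟨g, hg, fun z => by have := e z; linarith⟩

theorem deriv_chi_eq {g : ℝ → ℝ} (hg : ∀ z, AnalyticAt ℝ g z)
    (hchi : ∀ z, chi z = 1 - z ^ 2 * Real.exp (-z) / 12 + z ^ 3 * g z)
    (z : ℝ) : deriv chi z =
    -((2 * z - z ^ 2) * Real.exp (-z) / 12) + (3 * z ^ 2 * g z + z ^ 3 * deriv g z) := by
  rw [funext hchi]
  have := (((hasDerivAt_sq_mul_exp_neg z).div_const 12).const_sub 1).add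
    ((hasDerivAt_pow 3 z).mul (hg z).differentiableAt.hasDerivAt)
  exact this.deriv

theorem deriv_deriv_chi_eq {g : ℝ → ℝ} (hg : ∀ z, AnalyticAt ℝ g z)
    (hchi : ∀ z, chi z = 1 - z ^ 2 * Real.exp (-z) / 12 + z ^ 3 * g z)
    (z : ℝ) : deriv (deriv chi) z =
    -((2 - 4 * z + z ^ 2) * Real.exp (-z) / 12) +
      (6 * z * g z + 6 * z ^ 2 * deriv g z + z ^ 3 * deriv (deriv g) z) := by
  rw [funext (deriv_chi_eq hg hchi)]
  have := ((hasDerivAt_sub_sq_mul_exp_neg z).div_const 12).neg.add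
    ((((hasDerivAt_pow 2 z).const_mul 3).mul (hg z).differentiableAt.hasDerivAt).add
    ((hasDerivAt_pow 3 z).mul (hg z).deriv.differentiableAt.hasDerivAt))
  refine this.deriv.trans ?_
  push_cast
  ring

/-- The integrand `e^{-z} Q(z)` in terms of the remainder `g`. -/
theorem exp_neg_mul_Q_eq {g : ℝ → ℝ} (hg : ∀ z, AnalyticAt ℝ g z)
    (hchi : ∀ z, chi z = 1 - z ^ 2 * Real.exp (-z) / 12 + z ^ 3 * g z)
    {z : ℝ} (hz : 0 < z) : Real.exp (-z) * Q z =
    (4 - z) * Real.exp (-z) / 12 + 6 * g z + 6 * z * deriv g z + z ^ 2 * deriv (deriv g) z := by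
  have h0 := deriv_deriv_chi_eq hg hchi 0
  have h1 := deriv_deriv_chi_eq hg hchi z
  simp only [Q, xi, iteratedDeriv_succ, iteratedDeriv_zero, h0, h1]
  have h2 : Real.exp (-z) * Real.exp z = 1 := by rw [← Real.exp_add]; simp
  simp only [neg_zero, Real.exp_zero]
  field_simp
  linear_combination (-(2 - 4 * z + z ^ 2) * Real.exp (-z) +
      12 * (6 * z * g z + 6 * z ^ 2 * deriv g z + z ^ 3 * deriv (deriv g) z)) * h2


/-! ### Decay at infinity and integrability -/

theorem chi_eq_of_pos {z : ℝ} (hz : 0 < z) :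
    chi z = z ^ 2 * (Real.exp (-z) / (1 - Real.exp (-z)) ^ 2) := by
  rw [chi, if_neg hz.ne', div_pow]
  ring

theorem deriv_chi_eq_of_pos {z : ℝ} (hz : 0 < z) : deriv chi z =
    2 * z * (Real.exp (-z) / (1 - Real.exp (-z)) ^ 2) -
      z ^ 2 * ((Real.exp (-z) + Real.exp (-z) ^ 2) / (1 - Real.exp (-z)) ^ 3) := by
  have hne : 1 - Real.exp (-z) ≠ 0 := (sub_pos.2 (Real.exp_lt_one_iff.2 (neg_lt_zero.2 hz))).ne'
  have h : HasDerivAt (fun z => z ^ 2 * (Real.exp (-z) / (1 - Real.exp (-z)) ^ 2)) _ z :=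
    (hasDerivAt_pow 2 z).mul ((hasDerivAt_exp_neg z).div
      (((hasDerivAt_exp_neg z).const_sub 1).pow 2) (pow_ne_zero 2 hne))
  rw [Filter.EventuallyEq.deriv_eq (f := fun z => z ^ 2 * (Real.exp (-z) /
    (1 - Real.exp (-z)) ^ 2)), h.deriv]
  · field_simp
    push_cast
    ring
  · filter_upwards [isOpen_Ioi.mem_nhds hz] with x hx using chi_eq_of_pos hx

theorem deriv_deriv_chi_eq_of_pos {z : ℝ} (hz : 0 < z) : deriv (deriv chi) z =
    2 * (Real.exp (-z) / (1 - Real.exp (-z)) ^ 2) -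
      4 * z * ((Real.exp (-z) + Real.exp (-z) ^ 2) / (1 - Real.exp (-z)) ^ 3) +
      z ^ 2 * ((Real.exp (-z) + 4 * Real.exp (-z) ^ 2 + Real.exp (-z) ^ 3) /
        (1 - Real.exp (-z)) ^ 4) := by
  have hne : 1 - Real.exp (-z) ≠ 0 := (sub_pos.2 (Real.exp_lt_one_iff.2 (neg_lt_zero.2 hz))).ne'
  have h : HasDerivAt (fun z => 2 * z * (Real.exp (-z) / (1 - Real.exp (-z)) ^ 2) -
      z ^ 2 * ((Real.exp (-z) + Real.exp (-z) ^ 2) / (1 - Real.exp (-z)) ^ 3)) _ z :=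
    (((hasDerivAt_id z).const_mul 2).mul ((hasDerivAt_exp_neg z).div
      (((hasDerivAt_exp_neg z).const_sub 1).pow 2) (pow_ne_zero 2 hne))).sub
    ((hasDerivAt_pow 2 z).mul (((hasDerivAt_exp_neg z).add ((hasDerivAt_exp_neg z).pow 2)).div
      (((hasDerivAt_exp_neg z).const_sub 1).pow 3) (pow_ne_zero 3 hne)))
  rw [Filter.EventuallyEq.deriv_eq (f := fun z => 2 * z * (Real.exp (-z) /
      (1 - Real.exp (-z)) ^ 2) -
      z ^ 2 * ((Real.exp (-z) + Real.exp (-z) ^ 2) / (1 - Real.exp (-z)) ^ 3)), h.deriv]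
  · simp only [Pi.pow_apply, Pi.add_apply, Pi.div_apply, id]
    field_simp
    push_cast
    ring
  · filter_upwards [isOpen_Ioi.mem_nhds hz] with x hx using deriv_chi_eq_of_pos hx

theorem exp_neg_le_half {z : ℝ} (hz : 1 ≤ z) : Real.exp (-z) ≤ 1 / 2 := by
  rw [Real.exp_neg, one_div]
  exact inv_anti₀ two_pos (by linarith [Real.add_one_le_exp z])

theorem cube_mul_exp_neg_le {z : ℝ} (hz : 0 ≤ z) : z ^ 3 * Real.exp (-z) ≤ 6 := by
  have h := Real.pow_div_factorial_le_exp z hz 3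
  rw [Real.exp_neg, ← div_eq_mul_inv, div_le_iff₀ (Real.exp_pos z)]
  rw [div_le_iff₀ (by positivity)] at h
  norm_num [Nat.factorial] at h
  linarith

theorem div_one_sub_pow_le {x y c : ℝ} (hx : x ≤ 1 / 2) (n : ℕ)
    (hy0 : 0 ≤ y) (hy : y ≤ c * x) : 0 ≤ y / (1 - x) ^ n ∧ y / (1 - x) ^ n ≤ 2 ^ n * c * x := by
  have h1 : (0 : ℝ) < 1 - x := by linarith
  refine ⟨by positivity, ?_⟩
  rw [div_le_iff₀ (by positivity)]
  have h2 : 1 ≤ (2 * (1 - x)) ^ n := one_le_pow₀ (by linarith)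
  rw [mul_pow] at h2
  calc y ≤ c * x := hy
    _ ≤ (c * x) * (2 ^ n * (1 - x) ^ n) := le_mul_of_one_le_right (hy0.trans hy) h2
    _ = _ := by ring

/-- With `x = e^{-z} ≤ 1/2`, every term is at most a constant times `z² x`, and `z² x ≤ 6/z ≤ 6`.
The constants are `24 = 4·6`, `120 = (8 + 12)·6` and `648 = (8 + 48 + 52)·6`. -/
theorem chi_bounds {z : ℝ} (hz : 1 ≤ z) :
    |chi z| ≤ 24 ∧ |deriv chi z| ≤ 120 ∧ |deriv (deriv chi) z| ≤ 648 / z := by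
  have hz0 : 0 < z := by linarith
  have hx := exp_neg_le_half hz
  have hx0 := (Real.exp_pos (-z)).le
  have hx3 := cube_mul_exp_neg_le hz0.le
  have hx2 : z ^ 2 * Real.exp (-z) ≤ 6 / z := by
    rw [le_div_iff₀ hz0]; linarith
  have hz6 : 6 / z ≤ 6 := div_le_self (by norm_num) hz
  rw [chi_eq_of_pos hz0, deriv_chi_eq_of_pos hz0, deriv_deriv_chi_eq_of_pos hz0,
    show 648 / z = 108 * (6 / z) by ring]
  set x := Real.exp (-z)
  obtain ⟨a0, a1⟩ := div_one_sub_pow_le hx 2 (y := x) (c := 1) hx0 (by linarith)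
  obtain ⟨b0, b1⟩ := div_one_sub_pow_le hx 3 (y := x + x ^ 2) (c := 3 / 2) (by positivity)
    (by nlinarith)
  obtain ⟨c0, c1⟩ := div_one_sub_pow_le hx 4 (y := x + 4 * x ^ 2 + x ^ 3) (c := 13 / 4)
    (by positivity) (by nlinarith [mul_nonneg hx0 (sub_nonneg.2 hx), mul_nonneg hx0 hx0])
  norm_num at a1 b1 c1
  set s := x / (1 - x) ^ 2
  set s₁ := (x + x ^ 2) / (1 - x) ^ 3
  set s₂ := (x + 4 * x ^ 2 + x ^ 3) / (1 - x) ^ 4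
  have hzz : z ≤ z ^ 2 := by nlinarith
  have hz1 : (1 : ℝ) ≤ z ^ 2 := by nlinarith
  have u0 : 0 ≤ z ^ 2 * x := by positivity
  have g1 : s ≤ 4 * (z ^ 2 * x) := by nlinarith
  have g2 : 0 ≤ z * s ∧ z * s ≤ 4 * (z ^ 2 * x) :=
    ⟨by positivity, by nlinarith [mul_le_mul_of_nonneg_left a1 hz0.le,
      mul_le_mul_of_nonneg_right hzz hx0]⟩
  have g3 : 0 ≤ z ^ 2 * s ∧ z ^ 2 * s ≤ 4 * (z ^ 2 * x) :=
    ⟨by positivity, by nlinarith [mul_le_mul_of_nonneg_left a1 (sq_nonneg z)]⟩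
  have g4 : 0 ≤ z * s₁ ∧ z * s₁ ≤ 12 * (z ^ 2 * x) :=
    ⟨by positivity, by nlinarith [mul_le_mul_of_nonneg_left b1 hz0.le,
      mul_le_mul_of_nonneg_right hzz hx0]⟩
  have g5 : 0 ≤ z ^ 2 * s₁ ∧ z ^ 2 * s₁ ≤ 12 * (z ^ 2 * x) :=
    ⟨by positivity, by nlinarith [mul_le_mul_of_nonneg_left b1 (sq_nonneg z)]⟩
  have g6 : 0 ≤ z ^ 2 * s₂ ∧ z ^ 2 * s₂ ≤ 52 * (z ^ 2 * x) :=
    ⟨by positivity, by nlinarith [mul_le_mul_of_nonneg_left c1 (sq_nonneg z)]⟩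
  refine ⟨abs_le.2 ⟨by linarith, by linarith⟩, abs_le.2 ⟨by linarith, by linarith⟩,
    abs_le.2 ⟨by linarith, by linarith⟩⟩

/-- Solve the formulas for `χ` and `χ'` for `z³ g` and `z³ g'`. For the last bound, `e^{-z} Q = (χ''
+ e^{-z}/6) / z`, and `χ''` is already `O(1/z)`. -/
theorem remainder_bounds {g : ℝ → ℝ} (hg : ∀ z, AnalyticAt ℝ g z)
    (hchi : ∀ z, chi z = 1 - z ^ 2 * Real.exp (-z) / 12 + z ^ 3 * g z) {z : ℝ} (hz : 1 ≤ z) :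
    |g z| ≤ 26 / z ^ 3 ∧ |deriv g z| ≤ 201 / z ^ 3 ∧ |Real.exp (-z) * Q z| ≤ 649 / z ^ 2 := by
  have hz0 : 0 < z := by linarith
  obtain ⟨b0, b1, b2⟩ := chi_bounds hz
  have hx0 := (Real.exp_pos (-z)).le
  have hx3 := cube_mul_exp_neg_le hz0.le
  have hz2 : (1 : ℝ) ≤ z ^ 2 := one_le_pow₀ hz
  have hx2 : z ^ 2 * Real.exp (-z) ≤ 6 := by
    have : z ^ 2 ≤ z ^ 3 := pow_le_pow_right₀ hz (by norm_num)
    nlinarith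
  have hx1 : z * Real.exp (-z) ≤ 6 := by
    have : z ≤ z ^ 3 := le_self_pow₀ hz (by norm_num)
    nlinarith
  have u2 : 0 ≤ z ^ 2 * Real.exp (-z) := by positivity
  have u1 : 0 ≤ z * Real.exp (-z) := by positivity
  have hg3 : |z ^ 3 * g z| ≤ 26 := by
    have h := hchi z
    rw [abs_le] at b0 ⊢
    constructor <;> linarith
  have hg2 : |z ^ 2 * g z| ≤ 26 := by
    refine le_trans ?_ hg3
    rw [abs_mul, abs_mul, abs_of_pos (pow_pos hz0 2), abs_of_pos (pow_pos hz0 3)]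
    exact mul_le_mul_of_nonneg_right (pow_le_pow_right₀ hz (by norm_num)) (abs_nonneg _)
  have hd3 : |z ^ 3 * deriv g z| ≤ 201 := by
    have h := deriv_chi_eq hg hchi z
    rw [abs_le] at b1 hg2 ⊢
    constructor <;> linarith
  have hz3 : 0 < z ^ 3 := by positivity
  refine ⟨?_, ?_, ?_⟩
  · rw [le_div_iff₀ hz3, ← abs_of_pos hz3, ← abs_mul, mul_comm]
    exact hg3
  · rw [le_div_iff₀ hz3, ← abs_of_pos hz3, ← abs_mul, mul_comm]
    exact hd3
  · have h2 : Real.exp (-z) * Real.exp z = 1 := by rw [← Real.exp_add]; simp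
    have h3 : Real.exp (-z) * Q z = (deriv (deriv chi) z + Real.exp (-z) / 6) / z := by
      have h0 := analyticAt_chi_and_taylor.2.2
      simp only [Q, xi, iteratedDeriv_succ, iteratedDeriv_zero, h0, Real.exp_zero]
      field_simp
      linear_combination 6 * deriv (deriv chi) z * h2
    rw [h3, abs_div, abs_of_pos hz0, div_le_div_iff₀ hz0 (by positivity)]
    have h4 : |deriv (deriv chi) z + Real.exp (-z) / 6| * z ≤ 649 := by
      rw [← abs_of_pos hz0, ← abs_mul, abs_of_pos hz0]
      rw [le_div_iff₀ hz0, ← abs_of_pos hz0, ← abs_mul, abs_of_pos hz0] at b2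
      rw [abs_le] at b2 ⊢
      constructor <;> linarith
    calc _ = (|deriv (deriv chi) z + Real.exp (-z) / 6| * z) * z := by ring
      _ ≤ 649 * z := mul_le_mul_of_nonneg_right h4 hz0.le

theorem integrableOn_Ioi_of_le_div_sq {f : ℝ → ℝ} (hf : ContinuousOn f (Ioi 0))
    (hf' : ContinuousOn f (Icc 0 1)) {C : ℝ} (hC : ∀ z, 1 ≤ z → |f z| ≤ C / z ^ 2) :
    IntegrableOn f (Ioi 0) := by
  rw [← Ioc_union_Ioi_eq_Ioi (zero_le_one' ℝ)]
  refine ((hf'.integrableOn_Icc).mono_set Ioc_subset_Icc_self).union ?_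
  have h1 : IntegrableOn (fun z : ℝ => C * z ^ (-2 : ℝ)) (Ioi 1) :=
    (integrableOn_Ioi_rpow_of_lt (by norm_num) one_pos).const_mul C
  refine h1.mono' ((hf.mono (Ioi_subset_Ioi zero_le_one)).aestronglyMeasurable measurableSet_Ioi) ?_
  refine (ae_restrict_iff' measurableSet_Ioi).2 (Eventually.of_forall fun z hz => ?_)
  have hz' : (0 : ℝ) < z := one_pos.trans hz
  have := hC z (le_of_lt hz)
  rwa [Real.norm_eq_abs, Real.rpow_neg hz'.le, Real.rpow_two, ← div_eq_mul_inv]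

theorem integrable_remainder {g : ℝ → ℝ} (hg : ∀ z, AnalyticAt ℝ g z)
    (hchi : ∀ z, chi z = 1 - z ^ 2 * Real.exp (-z) / 12 + z ^ 3 * g z) :
    IntegrableOn g (Ioi 0) ∧ IntegrableOn (deriv g) (Ioi 0) ∧
      IntegrableOn (fun z => Real.exp (-z) * Q z) (Ioi 0) := by
  have hle : ∀ {A z : ℝ}, 0 ≤ A → 1 ≤ z → A / z ^ 3 ≤ A / z ^ 2 := fun hA hz =>
    div_le_div_of_nonneg_left hA (by positivity) (pow_le_pow_right₀ hz (by norm_num))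
  have c0 : Continuous g := continuous_iff_continuousAt.2 fun z => (hg z).continuousAt
  have c1 : Continuous (deriv g) := continuous_iff_continuousAt.2 fun z => (hg z).deriv.continuousAt
  have c2 : Continuous (deriv (deriv g)) :=
    continuous_iff_continuousAt.2 fun z => (hg z).deriv.deriv.continuousAt
  refine ⟨integrableOn_Ioi_of_le_div_sq c0.continuousOn c0.continuousOn fun z hz =>
      (remainder_bounds hg hchi hz).1.trans (hle (by norm_num) hz),
    integrableOn_Ioi_of_le_div_sq c1.continuousOn c1.continuousOn fun z hz =>
      (remainder_bounds hg hchi hz).2.1.trans (hle (by norm_num) hz), ?_⟩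
  have c3 : Continuous fun z => (4 - z) * Real.exp (-z) / 12 + 6 * g z + 6 * z * deriv g z +
    z ^ 2 * deriv (deriv g) z := by fun_prop
  refine (integrableOn_Ioi_of_le_div_sq c3.continuousOn c3.continuousOn (C := 649)
    fun z hz => ?_).congr_fun (fun z hz => (exp_neg_mul_Q_eq hg hchi hz).symm) measurableSet_Ioi
  rw [← exp_neg_mul_Q_eq hg hchi (one_pos.trans_le hz)]
  exact (remainder_bounds hg hchi hz).2.2

/-! ### The integral of the remainder and its Riemann sums -/

theorem integral_remainder {g : ℝ → ℝ} (hg : ∀ z, AnalyticAt ℝ g z)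
    (hchi : ∀ z, chi z = 1 - z ^ 2 * Real.exp (-z) / 12 + z ^ 3 * g z) :
    ∫ z in Ioi 0, g z = 1 / 2 * (∫ z in Ioi 0, Real.exp (-z) * Q z) - 1 / 8 := by
  obtain ⟨i0, -, i2⟩ := integrable_remainder hg hchi
  have hz0 : Tendsto (fun z : ℝ => z ^ 2 * Real.exp (-z)) atTop (𝓝 0) :=
    Real.tendsto_pow_mul_exp_neg_atTop_nhds_zero 2
  have hz1 : Tendsto (fun z : ℝ => z * Real.exp (-z)) atTop (𝓝 0) := by
    simpa using Real.tendsto_pow_mul_exp_neg_atTop_nhds_zero 1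
  have hz2 : Tendsto (fun z : ℝ => Real.exp (-z)) atTop (𝓝 0) := by
    simpa using Real.tendsto_pow_mul_exp_neg_atTop_nhds_zero 0
  have hinv : Tendsto (fun z : ℝ => 201 / z) atTop (𝓝 0) := tendsto_const_nhds.div_atTop tendsto_id
  have t0 : Tendsto (fun z => z * g z) atTop (𝓝 0) := by
    refine squeeze_zero_norm' ?_ hinv
    filter_upwards [eventually_ge_atTop 1] with z hz
    have hz0 : 0 < z := by linarith
    have h := (remainder_bounds hg hchi hz).1
    rw [Real.norm_eq_abs, abs_mul, abs_of_pos hz0]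
    calc z * |g z| ≤ z * (26 / z ^ 3) := mul_le_mul_of_nonneg_left h hz0.le
      _ = (26 / z) * (1 / z) := by field_simp
      _ ≤ (201 / z) * 1 := by
        gcongr
        · norm_num
        · exact div_le_self zero_le_one hz
      _ = 201 / z := mul_one _
  have t1 : Tendsto (fun z => z ^ 2 * deriv g z) atTop (𝓝 0) := by
    refine squeeze_zero_norm' ?_ hinv
    filter_upwards [eventually_ge_atTop 1] with z hz
    have hz0 : 0 < z := by linarith
    have h := (remainder_bounds hg hchi hz).2.1
    rw [Real.norm_eq_abs, abs_mul, abs_of_pos (by positivity)]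
    calc z ^ 2 * |deriv g z| ≤ z ^ 2 * (201 / z ^ 3) := mul_le_mul_of_nonneg_left h (by positivity)
      _ = 201 / z := by field_simp
  -- A primitive of `e^{-z} Q / 2 - g`, found by integrating by parts. It vanishes at infinity, and
  -- `G 0 = -3/24` is the source of the `-1/8` in `f₃`.
  let G : ℝ → ℝ := fun z => (z * Real.exp (-z) - 3 * Real.exp (-z)) / 24 + 2 * (z * g z) +
    z ^ 2 * deriv g z / 2
  have hG : ∀ z, HasDerivAt G ((4 - z) * Real.exp (-z) / 24 + 2 * g z + 3 * z * deriv g z +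
      z ^ 2 * deriv (deriv g) z / 2) z := by
    intro z
    refine ((((((hasDerivAt_id z).mul (hasDerivAt_exp_neg z)).sub
      ((hasDerivAt_exp_neg z).const_mul 3)).div_const 24).add
      (((hasDerivAt_id z).mul (hg z).differentiableAt.hasDerivAt).const_mul 2)).add
      (((hasDerivAt_pow 2 z).mul (hg z).deriv.differentiableAt.hasDerivAt).div_const 2)).congr_deriv
      ?_
    simp only [id]
    push_cast
    ring
  have hGt : Tendsto G atTop (𝓝 0) := by
    have := (((hz1.sub (hz2.const_mul 3)).div_const 24).add (t0.const_mul 2)).add (t1.div_const 2)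
    simpa using this
  have heq : EqOn (fun z => 1 / 2 * (Real.exp (-z) * Q z) - g z)
      (fun z => (4 - z) * Real.exp (-z) / 24 + 2 * g z + 3 * z * deriv g z +
      z ^ 2 * deriv (deriv g) z / 2) (Ioi 0) := by
    intro z hz
    simp only
    rw [exp_neg_mul_Q_eq hg hchi hz]
    ring
  have hint : IntegrableOn (fun z => 1 / 2 * (Real.exp (-z) * Q z) - g z) (Ioi 0) :=
    (i2.const_mul _).sub i0
  have h := integral_Ioi_of_hasDerivAt_of_tendsto' (fun z _ => hG z)
    (hint.congr_fun heq measurableSet_Ioi) hGt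
  rw [← setIntegral_congr_fun measurableSet_Ioi heq, integral_sub (i2.const_mul _) i0,
    integral_const_mul] at h
  have hG0 : G 0 = -(1 / 8) := by simp [G]; norm_num
  rw [hG0] at h
  linarith

/-- On one step, `f` differs from its right end value by at most the integral of `|f'|`. -/
theorem abs_mul_sub_integral_le {f : ℝ → ℝ} (hf : Differentiable ℝ f)
    (hf' : Continuous (deriv f)) {a ε : ℝ} (hε : 0 ≤ ε) :
    |ε * f (a + ε) - ∫ x in a..(a + ε), f x| ≤ ε * ∫ x in a..(a + ε), |deriv f x| := by
  have h1 : ε * f (a + ε) - ∫ x in a..(a + ε), f x = ∫ x in a..(a + ε), (f (a + ε) - f x) := by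
    rw [intervalIntegral.integral_sub intervalIntegrable_const
      (hf.continuous.intervalIntegrable _ _), intervalIntegral.integral_const]
    simp
  have h2 := intervalIntegral.norm_integral_le_of_norm_le_const (a := a) (b := a + ε)
    (f := fun x => f (a + ε) - f x) (C := ∫ x in a..(a + ε), |deriv f x|) (fun x hx => ?_)
  · rw [h1]
    rw [Real.norm_eq_abs, add_sub_cancel_left, abs_of_nonneg hε] at h2
    linarith
  · rw [uIoc_of_le (by linarith)] at hx
    rw [← intervalIntegral.integral_deriv_eq_sub (fun y _ => hf y) (hf'.intervalIntegrable _ _)]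
    refine (intervalIntegral.norm_integral_le_integral_norm hx.2).trans ?_
    exact intervalIntegral.integral_mono_interval hx.1.le hx.2 le_rfl
      (Eventually.of_forall fun y => abs_nonneg _) (hf'.abs.intervalIntegrable _ _)

/-- The right Riemann sums of step `ε` converge to the integral at rate `O(ε)`. -/
theorem abs_sub_integral_Ioi_le {f : ℝ → ℝ} (hf : Differentiable ℝ f) (hf' : Continuous (deriv f))
    (hi : IntegrableOn f (Ioi 0)) (hi' : IntegrableOn (deriv f) (Ioi 0)) {ε S : ℝ} (hε : 0 < ε)
    (hS : HasSum (fun n : ℕ => ε * f (((n : ℝ) + 1) * ε)) S) :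
    |S - ∫ x in Ioi 0, f x| ≤ ε * ∫ x in Ioi 0, |deriv f x| := by
  have hlim : Tendsto (fun n : ℕ => (n : ℝ) * ε) atTop atTop :=
    tendsto_natCast_atTop_atTop.atTop_mul_const hε
  have h1 := hS.tendsto_sum_nat.sub (intervalIntegral_tendsto_integral_Ioi 0 hi hlim)
  have h2 := (intervalIntegral_tendsto_integral_Ioi 0 hi'.abs hlim).const_mul ε
  refine le_of_tendsto_of_tendsto' h1.abs h2 fun n => ?_
  induction n with
  | zero => simp
  | succ n ih =>
    have hn : ((n + 1 : ℕ) : ℝ) * ε = n * ε + ε := by push_cast; ring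
    have h3 := abs_mul_sub_integral_le hf hf' (a := n * ε) hε.le
    rw [Finset.sum_range_succ, hn,
      ← intervalIntegral.integral_add_adjacent_intervals (b := n * ε)
        (hf.continuous.intervalIntegrable _ _) (hf.continuous.intervalIntegrable _ _),
      ← intervalIntegral.integral_add_adjacent_intervals (b := n * ε)
        (hf'.abs.intervalIntegrable _ _) (hf'.abs.intervalIntegrable _ _), mul_add, add_sub_add_comm,
      show ((n : ℝ) + 1) * ε = n * ε + ε by ring]
    exact (abs_add_le _ _).trans (add_le_add ih h3)

/-! ### The series for `ln Z` -/

/-- Expand each logarithm in MacMahon's product by `-log(1 - y) = ∑ yⁿ/n`; for fixed `n` the sum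
over the box is a product of two geometric sums. -/
theorem hasSum_log_partitionFunction {q : ℝ} (hq0 : 0 < q) (hq1 : q < 1) {M : ℕ} (hM : 0 < M)
    (N K : ℕ) :
    HasSum (fun n : ℕ => q ^ (n + 1) / (1 - q ^ (n + 1)) ^ 2 / ((n : ℝ) + 1) *
      ((1 - (q ^ (n + 1)) ^ M) * (1 - (q ^ (n + 1)) ^ N) * (1 - (q ^ (n + 1)) ^ K)))
      (Real.log (partitionFunction M N K q)) := by
  have hlt : ∀ m : ℕ, q ^ (m + 1) < 1 := fun m => pow_lt_one₀ hq0.le hq1 (Nat.succ_ne_zero m)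
  have hne : ∀ m : ℕ, 1 - q ^ (m + 1) ≠ 0 := fun m => (sub_pos.2 (hlt m)).ne'
  have hlog : ∀ m : ℕ, HasSum (fun n : ℕ => (q ^ (m + 1)) ^ (n + 1) / ((n : ℝ) + 1))
      (-Real.log (1 - q ^ (m + 1))) := fun m =>
    Real.hasSum_pow_div_log_of_abs_lt_one (by
      rw [abs_of_pos (pow_pos hq0 _)]; exact hlt m)
  have hZ : Real.log (partitionFunction M N K q) = ∑ i ∈ Finset.range N, ∑ j ∈ Finset.range M,
      (-Real.log (1 - q ^ (i + j + 1)) - -Real.log (1 - q ^ (i + j + K + 1))) := by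
    have e : ∀ i j : ℕ, i + j + 1 + K = i + j + K + 1 := fun i j => by ring
    rw [partitionFunction_eq_prod hq0 hq1 hM, Real.log_prod]
    · refine Finset.sum_congr rfl fun i _ => ?_
      rw [Real.log_prod]
      · refine Finset.sum_congr rfl fun j _ => ?_
        rw [e, Real.log_div (hne _) (hne _)]
        ring
      · intro j _
        rw [e]
        exact div_ne_zero (hne _) (hne _)
    · intro i _
      refine Finset.prod_ne_zero_iff.2 fun j _ => ?_
      rw [e]
      exact div_ne_zero (hne _) (hne _)
  rw [hZ]
  have hs := hasSum_sum (s := Finset.range N) fun i _ =>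
    hasSum_sum (s := Finset.range M) fun j _ => (hlog (i + j)).sub (hlog (i + j + K))
  refine hs.congr_fun fun n => ?_
  have hx : q ^ (n + 1) ≠ 1 := (hlt n).ne
  set x := q ^ (n + 1) with hxdef
  have hx' : 1 - x ≠ 0 := hne n
  have h1 : ∀ i j : ℕ, (q ^ (i + j + 1)) ^ (n + 1) / ((n : ℝ) + 1) -
      (q ^ (i + j + K + 1)) ^ (n + 1) / ((n : ℝ) + 1) =
      (x * (1 - x ^ K) / ((n : ℝ) + 1)) * (x ^ i * x ^ j) := by
    intro i j
    rw [pow_right_comm, pow_right_comm q _ (n + 1), ← hxdef]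
    ring
  have h2 : ∀ m : ℕ, ∑ i ∈ Finset.range m, x ^ i = (1 - x ^ m) / (1 - x) := by
    intro m
    rw [geom_sum_eq hx, ← neg_div_neg_eq, neg_sub, neg_sub]
  simp only [h1]
  simp only [← Finset.mul_sum, ← Finset.sum_mul]
  rw [h2, h2]
  field_simp

theorem hasSum_sq_mul_log_partitionFunction {a b c ε : ℝ} {M N K : ℕ} (ha : 0 < a) (hε : 0 < ε)
    (hM : (M : ℝ) = a / ε) (hN : (N : ℝ) = b / ε) (hK : (K : ℝ) = c / ε) :
    HasSum (fun n : ℕ => chi (((n : ℝ) + 1) * ε) / ((n : ℝ) + 1) ^ 3 *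
      ((1 - Real.exp (-a) ^ (n + 1)) * (1 - Real.exp (-b) ^ (n + 1)) *
        (1 - Real.exp (-c) ^ (n + 1))))
      (ε ^ 2 * Real.log (partitionFunction M N K (Real.exp (-ε)))) := by
  have hM0 : 0 < M := by
    have : (0 : ℝ) < M := by rw [hM]; positivity
    exact_mod_cast this
  have h := (hasSum_log_partitionFunction (Real.exp_pos (-ε))
    (Real.exp_lt_one_iff.2 (neg_lt_zero.2 hε)) hM0 N K).mul_left (ε ^ 2)
  refine h.congr_fun fun n => ?_
  have hp : ∀ {m : ℕ} {α : ℝ}, (m : ℝ) = α / ε →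
      (Real.exp (-ε) ^ (n + 1)) ^ m = Real.exp (-α) ^ (n + 1) := by
    intro m α hm
    rw [pow_right_comm, ← Real.exp_nat_mul, hm]
    congr 2
    field_simp
  have hx : Real.exp (-ε) ^ (n + 1) = Real.exp (-(((n : ℝ) + 1) * ε)) := by
    rw [← Real.exp_nat_mul]
    push_cast
    congr 1
    ring
  have hz : 0 < ((n : ℝ) + 1) * ε := by positivity
  rw [hp hM, hp hN, hp hK, hx, chi_eq_of_pos hz, ← mul_assoc (ε ^ 2)]
  congr 1
  field_simp

/-! ### Asymptotics of the eight terms -/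

/-- `g` is bounded on `[0, 1]` by compactness and beyond by its decay; replacing `e^{-z}` by `1`
costs at most `z³/12`. -/
theorem exists_abs_chi_sub_le : ∃ C : ℝ, 0 ≤ C ∧
    ∀ z : ℝ, 0 ≤ z → |chi z - 1 + z ^ 2 / 12| ≤ C * z ^ 3 := by
  obtain ⟨g, hg, hchi⟩ := exists_chi_eq
  have hc : Continuous g := continuous_iff_continuousAt.2 fun z => (hg z).continuousAt
  obtain ⟨B, hB⟩ := isCompact_Icc.exists_bound_of_continuousOn (s := Icc (0 : ℝ) 1) hc.continuousOn
  have hB0 : 0 ≤ B := (norm_nonneg _).trans (hB 0 ⟨le_rfl, zero_le_one⟩)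
  refine ⟨B + 26 + 1, by linarith, fun z hz => ?_⟩
  have hgz : |g z| ≤ B + 26 := by
    rcases le_total z 1 with h | h
    · have := hB z ⟨hz, h⟩
      rw [Real.norm_eq_abs] at this
      linarith
    · have := (remainder_bounds hg hchi h).1
      have h2 : 26 / z ^ 3 ≤ 26 := div_le_self (by norm_num) (one_le_pow₀ h)
      linarith
  have he : 0 ≤ 1 - Real.exp (-z) ∧ 1 - Real.exp (-z) ≤ z := by
    constructor
    · linarith [Real.exp_le_one_iff.2 (neg_nonpos.2 hz)]
    · linarith [Real.add_one_le_exp (-z)]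
  have h1 : chi z - 1 + z ^ 2 / 12 = z ^ 3 * g z + z ^ 2 * (1 - Real.exp (-z)) / 12 := by
    rw [hchi]; ring
  rw [h1]
  refine (abs_add_le _ _).trans ?_
  rw [abs_mul, abs_of_nonneg (pow_nonneg hz 3), abs_of_nonneg (a := _ / 12)
    (div_nonneg (mul_nonneg (sq_nonneg z) he.1) (by norm_num))]
  have h2 := mul_le_mul_of_nonneg_left hgz (pow_nonneg hz 3)
  have h3 := mul_le_mul_of_nonneg_left he.2 (sq_nonneg z)
  have h4 : 0 ≤ z ^ 3 := pow_nonneg hz 3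
  linarith

/-- The contribution of a factor `xⁿ` with `x ≤ r < 1`. -/
theorem exists_hasSum_chi_mul_pow {C : ℝ}
    (hC : ∀ z : ℝ, 0 ≤ z → |chi z - 1 + z ^ 2 / 12| ≤ C * z ^ 3) {ε x r : ℝ} (hε : 0 < ε)
    (hx0 : 0 ≤ x) (hxr : x ≤ r) (hr : r < 1) :
    ∃ S, HasSum (fun n : ℕ => chi (((n : ℝ) + 1) * ε) / ((n : ℝ) + 1) ^ 3 * x ^ (n + 1)) S ∧
      |S - (Li3 x + ε ^ 2 / 12 * Real.log (1 - x))| ≤ C * ε ^ 3 * (1 - r)⁻¹ := by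
  have hr0 : 0 ≤ r := hx0.trans hxr
  have hgeo := (hasSum_geometric_of_lt_one hr0 hr).mul_left (C * ε ^ 3)
  have hC0 : 0 ≤ C := by
    have := (abs_nonneg _).trans (hC 1 zero_le_one)
    linarith
  have hpow : ∀ n : ℕ, x ^ (n + 1) ≤ r ^ n := fun n =>
    (pow_le_pow_left₀ hx0 hxr _).trans (pow_le_pow_of_le_one hr0 hr.le (Nat.le_succ n))
  have h1 : HasSum (fun n : ℕ => x ^ (n + 1) / ((n : ℝ) + 1) ^ 3) (Li3 x) := by
    refine (Summable.of_nonneg_of_le (fun n => by positivity) (fun n => ?_)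
      (summable_geometric_of_lt_one hr0 hr)).hasSum
    refine (div_le_self (by positivity) (one_le_pow₀ ?_)).trans (hpow n)
    linarith [(Nat.cast_nonneg n : (0 : ℝ) ≤ n)]
  have h2 : HasSum (fun n : ℕ => x ^ (n + 1) / ((n : ℝ) + 1)) (-Real.log (1 - x)) :=
    Real.hasSum_pow_div_log_of_abs_lt_one (by rw [abs_of_nonneg hx0]; linarith)
  -- The division by `n³` cancels the growth of the cubic error, leaving a geometric series in `r`;
  -- as `r` does not depend on `x`, the bound is uniform.
  have hd : ∀ n : ℕ, ‖(chi (((n : ℝ) + 1) * ε) - 1 + (((n : ℝ) + 1) * ε) ^ 2 / 12) /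
      ((n : ℝ) + 1) ^ 3 * x ^ (n + 1)‖ ≤ C * ε ^ 3 * r ^ n := by
    intro n
    rw [Real.norm_eq_abs, abs_mul, abs_div, abs_of_pos (a := ((n : ℝ) + 1) ^ 3) (by positivity),
      abs_of_nonneg (pow_nonneg hx0 _)]
    refine mul_le_mul ?_ (hpow n) (pow_nonneg hx0 _) (by positivity)
    rw [div_le_iff₀ (by positivity)]
    refine (hC _ (by positivity)).trans (le_of_eq ?_)
    ring
  have h3 := (Summable.of_norm_bounded hgeo.summable hd).hasSum
  refine ⟨_, ((h1.sub (h2.mul_left (ε ^ 2 / 12))).add h3).congr_fun fun n => ?_, ?_⟩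
  · field_simp
    ring
  · have := tsum_of_norm_bounded hgeo hd
    rw [Real.norm_eq_abs] at this
    refine le_of_eq_of_le ?_ this
    congr 1
    ring

theorem hasSum_zeta_three :
    HasSum (fun n : ℕ => 1 / ((n : ℝ) + 1) ^ 3) (riemannZeta 3).re := by
  have h1 : Summable fun n : ℕ => 1 / ((n : ℝ) + 1) ^ 3 := by
    have := (summable_nat_add_iff 1).2 (Real.summable_one_div_nat_pow (p := 3).2 (by norm_num))
    simpa using this
  have h2 : riemannZeta 3 = ((∑' n : ℕ, 1 / ((n : ℝ) + 1) ^ 3 : ℝ) : ℂ) := by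
    rw [zeta_eq_tsum_one_div_nat_add_one_cpow (by norm_num)]
    push_cast
    refine tsum_congr fun n => ?_
    congr 1
    exact_mod_cast Complex.cpow_natCast ((n : ℂ) + 1) 3
  rw [h2, Complex.ofReal_re]
  exact h1.hasSum

theorem abs_log_one_sub_exp_neg_sub_log_le {ε : ℝ} (hε : 0 < ε) :
    |Real.log (1 - Real.exp (-ε)) - Real.log ε| ≤ ε := by
  have h1 : 1 - Real.exp (-ε) ≤ ε := by linarith [Real.add_one_le_exp (-ε)]
  have h2 : ε * Real.exp (-ε) ≤ 1 - Real.exp (-ε) := by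
    have h3 : Real.exp (-ε) * Real.exp ε = 1 := by rw [← Real.exp_add]; simp
    have := mul_le_mul_of_nonneg_left (Real.add_one_le_exp ε) (Real.exp_pos (-ε)).le
    linarith
  have h0 : 0 < ε * Real.exp (-ε) := by positivity
  have h4 := Real.log_le_log h0 h2
  have h5 := Real.log_le_log (h0.trans_le h2) h1
  rw [Real.log_mul hε.ne' (Real.exp_pos _).ne', Real.log_exp] at h4
  rw [abs_le]
  constructor <;> linarith

/-- The contribution of the constant term `1`. -/
theorem exists_hasSum_chi : ∃ C : ℝ, ∀ ε : ℝ, 0 < ε →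
    ∃ S, HasSum (fun n : ℕ => chi (((n : ℝ) + 1) * ε) / ((n : ℝ) + 1) ^ 3) S ∧
      |S - ((riemannZeta 3).re + 1 / 12 * (ε ^ 2 * Real.log ε) +
        ε ^ 2 * (1 / 2 * (∫ z in Ioi 0, Real.exp (-z) * Q z) - 1 / 8))| ≤ C * ε ^ 3 := by
  obtain ⟨g, hg, hchi⟩ := exists_chi_eq
  obtain ⟨i0, i1, -⟩ := integrable_remainder hg hchi
  have hc : Continuous g := continuous_iff_continuousAt.2 fun z => (hg z).continuousAt
  have hc' : Continuous (deriv g) := continuous_iff_continuousAt.2 fun z => (hg z).deriv.continuousAt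
  obtain ⟨B, hB⟩ := isCompact_Icc.exists_bound_of_continuousOn (s := Icc (0 : ℝ) 1) hc.continuousOn
  have hB0 : 0 ≤ B := (norm_nonneg _).trans (hB 0 ⟨le_rfl, zero_le_one⟩)
  have hgz : ∀ z, 0 < z → |g z| ≤ (B + 26) / z ^ 2 := by
    intro z hz
    rw [le_div_iff₀ (by positivity)]
    rcases le_total z 1 with h | h
    · have h1 := hB z ⟨hz.le, h⟩
      rw [Real.norm_eq_abs] at h1
      have h2 : z ^ 2 ≤ 1 := pow_le_one₀ hz.le h
      nlinarith [abs_nonneg (g z)]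
    · have h1 := (remainder_bounds hg hchi h).1
      rw [le_div_iff₀ (by positivity)] at h1
      have h2 : z ^ 2 ≤ z ^ 3 := pow_le_pow_right₀ h (by norm_num)
      nlinarith [abs_nonneg (g z)]
  -- `1/12` pays for replacing `log (1 - e^{-ε})` by `log ε`, the integral for the Riemann sum.
  refine ⟨1 / 12 + ∫ z in Ioi 0, |deriv g z|, fun ε hε => ?_⟩
  have hsum : Summable fun n : ℕ => ε * g (((n : ℝ) + 1) * ε) := by
    have h1 : Summable fun n : ℕ => (B + 26) / ε * (1 / ((n : ℝ) + 1) ^ 2) := by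
      have := (summable_nat_add_iff 1).2 (Real.summable_one_div_nat_pow (p := 2).2 (by norm_num))
      refine Summable.mul_left _ ?_
      simpa using this
    refine Summable.of_norm_bounded h1 fun n => ?_
    rw [Real.norm_eq_abs, abs_mul, abs_of_pos hε]
    refine (mul_le_mul_of_nonneg_left (hgz _ (by positivity)) hε.le).trans (le_of_eq ?_)
    field_simp
  have hR := abs_sub_integral_Ioi_le (fun z => (hg z).differentiableAt) hc' i0 i1 hε hsum.hasSum
  rw [integral_remainder hg hchi] at hR
  have h2 : HasSum (fun n : ℕ => Real.exp (-ε) ^ (n + 1) / ((n : ℝ) + 1))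
      (-Real.log (1 - Real.exp (-ε))) :=
    Real.hasSum_pow_div_log_of_abs_lt_one (by
      rw [abs_of_pos (Real.exp_pos _)]; exact Real.exp_lt_one_iff.2 (neg_lt_zero.2 hε))
  refine ⟨_, ((hasSum_zeta_three.sub (h2.mul_left (ε ^ 2 / 12))).add
    (hsum.hasSum.mul_left (ε ^ 2))).congr_fun fun n => ?_, ?_⟩
  · have hx : Real.exp (-ε) ^ (n + 1) = Real.exp (-(((n : ℝ) + 1) * ε)) := by
      rw [← Real.exp_nat_mul]
      push_cast
      congr 1
      ring
    rw [hx, hchi]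
    field_simp
  · have hL := abs_log_one_sub_exp_neg_sub_log_le hε
    set S := ∑' n : ℕ, ε * g (((n : ℝ) + 1) * ε)
    set J := 1 / 2 * (∫ z in Ioi 0, Real.exp (-z) * Q z) - 1 / 8
    set l := Real.log (1 - Real.exp (-ε))
    have e : (riemannZeta 3).re - ε ^ 2 / 12 * -l + ε ^ 2 * S - ((riemannZeta 3).re +
        1 / 12 * (ε ^ 2 * Real.log ε) + ε ^ 2 * J) =
        ε ^ 2 / 12 * (l - Real.log ε) + ε ^ 2 * (S - J) := by ring
    rw [e]
    refine (abs_add_le _ _).trans ?_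
    rw [abs_mul, abs_mul, abs_of_pos (a := ε ^ 2 / 12) (by positivity),
      abs_of_pos (a := ε ^ 2) (by positivity)]
    have h3 := mul_le_mul_of_nonneg_left hL (a := ε ^ 2 / 12) (by positivity)
    have h4 := mul_le_mul_of_nonneg_left hR (a := ε ^ 2) (by positivity)
    linarith

/-! ### Assembling the expansion -/

/-- Write `e^x - 1 = e^x (1 - e^{-x})`; the linear terms cancel, since numerator and denominator
both give `2(a + b + c)`. -/
theorem log_quotient_eq {a b c : ℝ} (ha : 0 < a) (hb : 0 < b) (hc : 0 < c) :
    Real.log (((Real.exp a - 1) * (Real.exp b - 1) * (Real.exp c - 1) * (Real.exp (a + b + c) - 1)) /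
      ((Real.exp (a + b) - 1) * (Real.exp (b + c) - 1) * (Real.exp (a + c) - 1))) =
    Real.log (1 - Real.exp (-a)) + Real.log (1 - Real.exp (-b)) + Real.log (1 - Real.exp (-c)) +
      Real.log (1 - Real.exp (-a - b - c)) - Real.log (1 - Real.exp (-a - b)) -
      Real.log (1 - Real.exp (-b - c)) - Real.log (1 - Real.exp (-a - c)) := by
  have hne : ∀ {x : ℝ}, 0 < x → Real.exp x - 1 ≠ 0 := fun hx =>
    (sub_pos.2 (Real.one_lt_exp_iff.2 hx)).ne'
  have hl : ∀ {x : ℝ}, 0 < x → Real.log (Real.exp x - 1) = x + Real.log (1 - Real.exp (-x)) := by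
    intro x hx
    have h1 : 1 - Real.exp (-x) ≠ 0 := (sub_pos.2 (Real.exp_lt_one_iff.2 (neg_lt_zero.2 hx))).ne'
    have h2 : Real.exp x * Real.exp (-x) = 1 := by rw [← Real.exp_add]; simp
    rw [show Real.exp x - 1 = Real.exp x * (1 - Real.exp (-x)) by linear_combination h2,
      Real.log_mul (Real.exp_pos x).ne' h1, Real.log_exp]
  have ha' := hne ha
  have hb' := hne hb
  have hc' := hne hc
  have hab := hne (add_pos ha hb)
  have hbc := hne (add_pos hb hc)
  have hac := hne (add_pos ha hc)
  have habc := hne (add_pos (add_pos ha hb) hc)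
  rw [Real.log_div (by simp [*]) (by simp [*]), Real.log_mul (by simp [*]) habc,
    Real.log_mul (by simp [*]) hc', Real.log_mul ha' hb', Real.log_mul (by simp [*]) hac,
    Real.log_mul hab hbc, hl ha, hl hb, hl hc, hl (add_pos ha hb), hl (add_pos hb hc),
    hl (add_pos ha hc), hl (add_pos (add_pos ha hb) hc),
    show -(a + b + c) = -a - b - c by ring, show -(a + b) = -a - b by ring,
    show -(b + c) = -b - c by ring, show -(a + c) = -a - c by ring]
  ring

theorem exists_abs_freeEnergy_sub_le {δ : ℝ} (hδ : 0 < δ) :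
    ∃ C : ℝ, ∀ a b c : ℝ, δ ≤ a → δ ≤ b → δ ≤ c → ∀ ε : ℝ, 0 < ε →
      ∀ M N K : ℕ, (M : ℝ) = a / ε → (N : ℝ) = b / ε → (K : ℝ) = c / ε →
        |freeEnergy M N K ε - (f0 a b c + f1 * ε + f2 a b c * (ε ^ 2 * Real.log ε) +
          f3 a b c * ε ^ 2)| ≤ C * ε ^ 3 := by
  obtain ⟨C₁, hC₁⟩ := exists_hasSum_chi
  obtain ⟨C₂, hC₂0, hC₂⟩ := exists_abs_chi_sub_le
  have hr : Real.exp (-δ) < 1 := Real.exp_lt_one_iff.2 (neg_lt_zero.2 hδ)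
  -- `ab + bc + ca ≥ 3δ²` bounds the prefactor, and each of the seven exponential terms is handled
  -- with `r = e^{-δ}`.
  refine ⟨1 / (2 * (3 * δ ^ 2)) * (C₁ + 7 * (C₂ * (1 - Real.exp (-δ))⁻¹)),
    fun a b c ha hb hc ε hε M N K hM hN hK => ?_⟩
  have ha0 := hδ.trans_le ha
  have hb0 := hδ.trans_le hb
  have hc0 := hδ.trans_le hc
  obtain ⟨S, hS, eS⟩ := hC₁ ε hε
  have key : ∀ α, δ ≤ α → _ := fun α hα =>
    exists_hasSum_chi_mul_pow hC₂ hε (Real.exp_pos (-α)).le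
      (Real.exp_le_exp.2 (neg_le_neg hα)) hr
  obtain ⟨Sa, hSa, ea⟩ := key a ha
  obtain ⟨Sb, hSb, eb⟩ := key b hb
  obtain ⟨Sc, hSc, ec⟩ := key c hc
  obtain ⟨Sab, hSab, eab⟩ := key (a + b) (by linarith)
  obtain ⟨Sbc, hSbc, ebc⟩ := key (b + c) (by linarith)
  obtain ⟨Sac, hSac, eac⟩ := key (a + c) (by linarith)
  obtain ⟨Sabc, hSabc, eabc⟩ := key (a + b + c) (by linarith)
  have hlogZ : ε ^ 2 * Real.log (partitionFunction M N K (Real.exp (-ε))) =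
      S - Sa - Sb - Sc + Sab + Sbc + Sac - Sabc := by
    refine (hasSum_sq_mul_log_partitionFunction ha0 hε hM hN hK).unique ?_
    refine (((((((hS.sub hSa).sub hSb).sub hSc).add hSab).add hSbc).add hSac).sub
      hSabc).congr_fun fun n => ?_
    simp only [neg_add, Real.exp_add, mul_pow]
    ring
  simp only [neg_add, ← sub_eq_add_neg] at eab ebc eac eabc
  have hD : 3 * δ ^ 2 ≤ a * b + b * c + c * a := by
    nlinarith [mul_le_mul ha hb hδ.le ha0.le, mul_le_mul hb hc hδ.le hb0.le,
      mul_le_mul hc ha hδ.le hc0.le]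
  have hDpos : 0 < a * b + b * c + c * a := by positivity
  have hf : freeEnergy M N K ε = -(1 / (2 * (a * b + b * c + c * a))) *
      (S - Sa - Sb - Sc + Sab + Sbc + Sac - Sabc) := by
    rw [← hlogZ, freeEnergy, numVertices]
    push_cast
    rw [hM, hN, hK]
    field_simp
  rw [hf, f0, f1, f2, f3, log_quotient_eq ha0 hb0 hc0]
  set D := a * b + b * c + c * a
  set J := ∫ z in Ioi (0 : ℝ), Real.exp (-z) * Q z
  set E := C₂ * ε ^ 3 * (1 - Real.exp (-δ))⁻¹
  have hmain : ∀ T : ℝ, |T| ≤ C₁ * ε ^ 3 + 7 * E → |(-(1 / (2 * D))) * T| ≤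
      1 / (2 * (3 * δ ^ 2)) * (C₁ + 7 * (C₂ * (1 - Real.exp (-δ))⁻¹)) * ε ^ 3 := by
    intro T hT
    rw [abs_mul, abs_neg, abs_of_pos (by positivity), mul_assoc]
    refine mul_le_mul (one_div_le_one_div_of_le (by positivity) (by linarith)) (hT.trans (le_of_eq ?_))
      (abs_nonneg _) (by positivity)
    simp only [E]
    ring
  refine le_trans (le_of_eq ?_) (hmain ((S - ((riemannZeta 3).re + 1 / 12 * (ε ^ 2 * Real.log ε) +
      ε ^ 2 * (1 / 2 * J - 1 / 8)))
    - (Sa - (Li3 (Real.exp (-a)) + ε ^ 2 / 12 * Real.log (1 - Real.exp (-a))))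
    - (Sb - (Li3 (Real.exp (-b)) + ε ^ 2 / 12 * Real.log (1 - Real.exp (-b))))
    - (Sc - (Li3 (Real.exp (-c)) + ε ^ 2 / 12 * Real.log (1 - Real.exp (-c))))
    + (Sab - (Li3 (Real.exp (-a - b)) + ε ^ 2 / 12 * Real.log (1 - Real.exp (-a - b))))
    + (Sbc - (Li3 (Real.exp (-b - c)) + ε ^ 2 / 12 * Real.log (1 - Real.exp (-b - c))))
    + (Sac - (Li3 (Real.exp (-a - c)) + ε ^ 2 / 12 * Real.log (1 - Real.exp (-a - c))))
    - (Sabc - (Li3 (Real.exp (-a - b - c)) + ε ^ 2 / 12 * Real.log (1 - Real.exp (-a - b - c))))) ?_)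
  · congr 1
    ring
  · rw [abs_le] at *
    constructor <;> linarith

end HexDimer

theorem mainTheorem1 :
    MeasureTheory.IntegrableOn (fun z : ℝ => Real.exp (-z) * HexDimer.Q z) (Set.Ioi 0) ∧
    ∀ δ : ℝ, 0 < δ →
      ∃ C : ℝ, ∃ ε₀ : ℝ, 0 < ε₀ ∧
        ∀ a b c : ℝ, δ ≤ a → δ ≤ b → δ ≤ c →
        ∀ ε : ℝ, 0 < ε → ε < ε₀ →
        ∀ M N K : ℕ, (M : ℝ) = a / ε → (N : ℝ) = b / ε → (K : ℝ) = c / ε →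
          |HexDimer.freeEnergy M N K ε -
              (HexDimer.f0 a b c + HexDimer.f1 * ε + HexDimer.f2 a b c * (ε ^ 2 * Real.log ε) +
                HexDimer.f3 a b c * ε ^ 2)| ≤ C * ε ^ 3 := by
  constructor
  · obtain ⟨g, hg, hchi⟩ := HexDimer.exists_chi_eq
    exact (HexDimer.integrable_remainder hg hchi).2.2
  · intro δ hδ
    obtain ⟨C, hC⟩ := HexDimer.exists_abs_freeEnergy_sub_le hδ
    -- The estimate holds for every `ε > 0`, so the threshold `1` is arbitrary.
    exact ⟨C, 1, one_pos, fun a b c ha hb hc ε hε _ => hC a b c ha hb hc ε hε⟩
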